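/- \textbf{Theorem (Local-SVRG, heterogeneous data).} Let $n,m\ge 1$, $f_{ij}:\mathbb R^d\to\mathbb R$ $(i\in[n],\,j\in[m])$, $f_i=\frac1m\sum_{j=1}^m f_{ij}$, $f=\frac1n\sum_{i=1}^n f_i$, and let $x^*$ be a minimizer of $f$. Assume that every $f_i$ is $\mu$-strongly convex ($\mu\ge 0$) and $L$-smooth (differentiable with $L$-Lipschitz gradient, $L\ge 0$) and that every $f_{ij}$ is convex and $\max L_{ij}$-smooth, where $\max L_{ij}\ge 0$ denotes one common constant. Let $\gamma>0$, $q\in(0,1)$, an integer $\tau\ge1$, $x^0\in\mathbb R^d$ and $w_1^0,\dots,w_n^0\in\mathbb R^d$ (for instance $w_i^0=x^0$) be given. Local-SVRG starts from $x_i^0=x^0$ and, for $k=0,1,\dots$ and $i\in[n]$, samples $j_i$ uniformly from $[m]$, independently across the nodes, and sets $$g_i^k=\nabla f_{ij_i}(x_i^k)-\nabla f_{ij_i}(w_i^k)+\nabla f_i(w_i^k),\qquad w_i^{k+1}=\begin{cases}x_i^k&\text{w.p. } q\\ w_i^k&\text{w.p. } 1-q,\end{cases}$$ $$x_i^{k+1}=\begin{cases}\frac1n\sum_{l=1}^n(x_l^k-\gamma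 g_l^k)&\text{if }\tau\mid k+1\\ x_i^k-\gamma g_i^k&\text{otherwise,}\end{cases}$$ the random choices of different iterations being independent. Put $x^k=\frac1n\sum_i x_i^k$, $V_k=\frac1n\sum_i\|x_i^k-x^k\|^2$, $\bar g_i^k=\mathbf E[g_i^k\mid x_1^k,\dots,x_n^k]$, $\zeta_*^2=\frac1n\sum_i\|\nabla f_i(x^*)\|^2$, $\sigma_k^2=\frac4{nm}\sum_{i,j}\|\nabla f_{ij}(w_i^k)-\nabla f_{ij}(x^*)\|^2$, $w_k=(1-\min\{\gamma\mu,\frac q4\})^{-(k+1)}$, $W_K=\sum_{k=0}^K w_k$, $\overline x^K=\frac1{W_K}\sum_{k=0}^K w_kx^k$. Suppose that $$\gamma\le\min\left\{\frac1{2\left(\frac{44\max L_{ij}}n+L\right)},\ \frac1{4\sqrt{2eL(\tau-1)\left(3L(\tau-1)+4\max L_{ij}+\frac{8\max L_{ij}}{1-q}\right)}}\right\},$$ where a fraction with denominator $0$ is read as $+\infty$. (a) For all $k\ge0$, $\mathbf E_k\left[\frac1n\sum_i g_i^k\right]=\frac1n\sum_i\nabla f_i(x_i^k)$, with $\mathbf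 E_k$ the conditional expectation given the random choices of the iterations before $k$, and, with $r_k=\mathbf E[f(x^k)-f(x^*)]$, $$\tfrac1n\sum_i\mathbf E\|g_i^k\|^2\le 2(3L+4\max L_{ij})r_k+\tfrac12\mathbf E\sigma_k^2+(3L^2+4L\max L_{ij})\mathbf EV_k+3\zeta_*^2,$$ $$\tfrac1n\sum_i\mathbf E\|\bar g_i^k\|^2\le 6Lr_k+3L^2\mathbf EV_k+3\zeta_*^2,$$ $$\tfrac1n\sum_i\mathbf E\|g_i^k-\bar g_i^k\|^2\le 8\max L_{ij}\,r_k+\tfrac12\mathbf E\sigma_k^2+4L\max L_{ij}\,\mathbf EV_k,$$ $$\mathbf E\left\|\tfrac1n\sum_i g_i^k\right\|^2\le 2\left(\tfrac{4\max L_{ij}}n+L\right)r_k+\tfrac1n\mathbf E\sigma_k^2+\left(\tfrac{4L\max L_{ij}}n+2L^2\right)\mathbf EV_k,$$ $$\mathbf E\sigma_{k+1}^2\le(1-q)\mathbf E\sigma_k^2+16q\max L_{ij}\,r_k+8qL\max L_{ij}\,\mathbf EV_k,$$ and for all $K\ge0$, with $H=\frac{2e(\tau-1)(2+q)\gamma^2}q$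 and $D_3=6e(\tau-1)^2\zeta_*^2$, $$2L\sum_{k=0}^Kw_k\mathbf EV_k\le\tfrac12\sum_{k=0}^Kw_kr_k+2LH\,\mathbf E\sigma_0^2+2LD_3\gamma^2W_K.$$ All random variables whose expectations occur here and in (b) are integrable. (b) Put $\Phi^0=2\|x^0-x^*\|^2+\frac8{3nq}\gamma^2\sigma_0^2+\frac{8eL(\tau-1)(2+q)\gamma^3}q\sigma_0^2$. For all $K\ge0$, $$\mathbf E[f(\overline x^K)-f(x^*)]\le\frac{\Phi^0}{\gamma W_K}+24eL(\tau-1)^2\zeta_*^2\gamma^2.$$ If $\mu>0$, then for all $K\ge0$ $$\mathbf E[f(\overline x^K)-f(x^*)]\le\left(1-\min\left\{\gamma\mu,\tfrac q4\right\}\right)^K\frac{\Phi^0}\gamma+24eL(\tau-1)^2\zeta_*^2\gamma^2,$$ and if $\mu=0$, then for all $K\ge1$ $$\mathbf E[f(\overline x^K)-f(x^*)]\le\frac{\Phi^0}{\gamma K}+24eL(\tau-1)^2\zeta_*^2\gamma^2.$$ -/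

import Mathlib

open MeasureTheory ProbabilityTheory
open scoped Gradient

namespace LocalSVRG

noncomputable section

/-- The space `ℝ^d` with its Euclidean norm. -/
abbrev Vec (d : ℕ) : Type := EuclideanSpace ℝ (Fin d)

/-- `L`-smoothness: differentiable with an `L`-Lipschitz gradient. -/
def IsSmooth {d : ℕ} (L : ℝ) (h : Vec d → ℝ) : Prop :=
  Differentiable ℝ h ∧ ∀ x y, ‖∇ h x - ∇ h y‖ ≤ L * ‖x - y‖

/-- The local objective `f_i = (1/m) ∑_j f_{ij}`. -/
def localObj {d n m : ℕ} (F : Fin n → Fin m → Vec d → ℝ) (i : Fin n) (x : Vec d) : ℝ :=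
  (1 / (m : ℝ)) * ∑ j, F i j x

/-- The global objective `f = (1/n) ∑_i f_i` of a family of local objectives. -/
def globalObj {d n : ℕ} (f : Fin n → Vec d → ℝ) (x : Vec d) : ℝ :=
  (1 / (n : ℝ)) * ∑ i, f i x

/-- Heterogeneity at the point `xs`: `ζ_*² = (1/n) ∑_i ‖∇ f_i(xs)‖²`. -/
def zetaStarSq {d n : ℕ} (f : Fin n → Vec d → ℝ) (xs : Vec d) : ℝ :=
  (1 / (n : ℝ)) * ∑ i, ‖∇ (f i) xs‖ ^ 2

/-- The mean `(1/n) ∑_i y_i`; for local iterates this is the virtual iterate. -/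
def mean {d n : ℕ} (y : Fin n → Vec d) : Vec d :=
  (1 / (n : ℝ)) • ∑ i, y i

/-- The discrepancy `V = (1/n) ∑_i ‖y_i - mean y‖²`. -/
def discrepancy {d n : ℕ} (y : Fin n → Vec d) : ℝ :=
  (1 / (n : ℝ)) * ∑ i, ‖y i - mean y‖ ^ 2

/-- The weight `w_k = (1 - min {γ μ, ρ/4})^{-(k+1)}`. -/
def weight (γ μ ρ : ℝ) (k : ℕ) : ℝ :=
  1 / (1 - min (γ * μ) (ρ / 4)) ^ (k + 1)

/-- `W_K = ∑_{k=0}^K w_k`. -/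
def weightSum (γ μ ρ : ℝ) (K : ℕ) : ℝ :=
  ∑ k ∈ Finset.range (K + 1), weight γ μ ρ k

/-- The weighted average `(1/W_K) ∑_{k=0}^K w_k y_k`. -/
def weightedAvg {d : ℕ} (γ μ ρ : ℝ) (y : ℕ → Vec d) (K : ℕ) : Vec d :=
  (1 / weightSum γ μ ρ K) • ∑ k ∈ Finset.range (K + 1), weight γ μ ρ k • y k

/-! ### The algorithm, along one realization of its random choices -/

/-- The loopless SVRG direction of node `i` with sampled index `j`, local iterate `x` and
reference point `w`. -/
def direction {d n m : ℕ} (F : Fin n → Fin m → Vec d → ℝ) (i : Fin n) (j : Fin m)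
    (x w : Vec d) : Vec d :=
  ∇ (F i j) x - ∇ (F i j) w + ∇ (localObj F i) w

/-- The local iterates `(x_i^k)_i` (first component) and the reference points `(w_i^k)_i`
(second component) of Local-SVRG with stepsize `γ`, loop length `τ`, starting point `x0` and
initial reference points `w0`, when node `i` samples the index `j k i` in iteration `k` and
refreshes its reference point in iteration `k` exactly if `b k i` is `true`. -/
def state {d n m : ℕ} (F : Fin n → Fin m → Vec d → ℝ) (γ : ℝ) (τ : ℕ) (x0 : Vec d)
    (w0 : Fin n → Vec d) (j : ℕ → Fin n → Fin m) (b : ℕ → Fin n → Bool) :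
    ℕ → (Fin n → Vec d) × (Fin n → Vec d)
  | 0 => (fun _ => x0, w0)
  | k + 1 =>
    let x := (state F γ τ x0 w0 j b k).1
    let w := (state F γ τ x0 w0 j b k).2
    let y : Fin n → Vec d := fun i => x i - γ • direction F i (j k i) (x i) (w i)
    (fun i => if (k + 1) % τ = 0 then mean y else y i,
     fun i => if b k i = true then x i else w i)

/-! ### Randomness -/

/-- The random choices of Local-SVRG: in every iteration the nodes sample their indices uniformly
and independently of each other, every node refreshes its reference point with probability `q`,
and different iterations are independent. Within one iteration nothing is required of the joint
law of the coins, nor of their dependence on the indices: independent coins and one coin shared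
by all the nodes are both covered. -/
structure IsSampling {Ω : Type*} [MeasurableSpace Ω] (P : Measure Ω) {n m : ℕ} (q : ℝ)
    (J : ℕ → Fin n → Ω → Fin m) (B : ℕ → Fin n → Ω → Bool) : Prop where
  measurable_index : ∀ k i, Measurable (J k i)
  measurable_coin : ∀ k i, Measurable (B k i)
  uniform_index : ∀ k i j, P.real {ω | J k i ω = j} = 1 / (m : ℝ)
  coin_prob : ∀ k i, P.real {ω | B k i ω = true} = q
  indep_nodes : ∀ k, iIndepFun (J k) P
  indep_iterations : iIndepFun (fun (k : ℕ) (ω : Ω) =>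
    ((fun i => J k i ω : Fin n → Fin m), (fun i => B k i ω : Fin n → Bool))) P

/-- The sigma-algebra of all the random choices made before iteration `k`. -/
@[reducible] def history {Ω : Type*} {n m : ℕ} (J : ℕ → Fin n → Ω → Fin m) (B : ℕ → Fin n → Ω → Bool)
    (k : ℕ) : MeasurableSpace Ω :=
  ⨆ l : Fin k, MeasurableSpace.comap (fun ω : Ω =>
    ((fun i => J l i ω : Fin n → Fin m), (fun i => B l i ω : Fin n → Bool))) inferInstance

/-- The random local iterates `x_i^k`. -/
def iterate {Ω : Type*} {d n m : ℕ} (F : Fin n → Fin m → Vec d → ℝ) (γ : ℝ) (τ : ℕ)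
    (x0 : Vec d) (w0 : Fin n → Vec d) (J : ℕ → Fin n → Ω → Fin m) (B : ℕ → Fin n → Ω → Bool)
    (k : ℕ) (i : Fin n) (ω : Ω) : Vec d :=
  (state F γ τ x0 w0 (fun k i => J k i ω) (fun k i => B k i ω) k).1 i

/-- The random reference points `w_i^k`. -/
def refPoint {Ω : Type*} {d n m : ℕ} (F : Fin n → Fin m → Vec d → ℝ) (γ : ℝ) (τ : ℕ)
    (x0 : Vec d) (w0 : Fin n → Vec d) (J : ℕ → Fin n → Ω → Fin m) (B : ℕ → Fin n → Ω → Bool)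
    (k : ℕ) (i : Fin n) (ω : Ω) : Vec d :=
  (state F γ τ x0 w0 (fun k i => J k i ω) (fun k i => B k i ω) k).2 i

/-- The random local directions `g_i^k`. -/
def stochGrad {Ω : Type*} {d n m : ℕ} (F : Fin n → Fin m → Vec d → ℝ) (γ : ℝ) (τ : ℕ)
    (x0 : Vec d) (w0 : Fin n → Vec d) (J : ℕ → Fin n → Ω → Fin m) (B : ℕ → Fin n → Ω → Bool)
    (k : ℕ) (i : Fin n) (ω : Ω) : Vec d :=
  direction F i (J k i ω) (iterate F γ τ x0 w0 J B k i ω) (refPoint F γ τ x0 w0 J B k i ω)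

/-- `(4/(nm)) ∑_i ∑_j ‖∇ f_{ij}(w_i) - ∇ f_{ij}(xs)‖²`. -/
def refVariance {d n m : ℕ} (F : Fin n → Fin m → Vec d → ℝ) (xs : Vec d)
    (w : Fin n → Vec d) : ℝ :=
  (4 / ((n : ℝ) * (m : ℝ))) * ∑ i, ∑ j, ‖∇ (F i j) (w i) - ∇ (F i j) xs‖ ^ 2

/-- The random quantity `σ_k²`. -/
def sigmaSq {Ω : Type*} {d n m : ℕ} (F : Fin n → Fin m → Vec d → ℝ) (γ : ℝ) (τ : ℕ)
    (x0 : Vec d) (w0 : Fin n → Vec d) (J : ℕ → Fin n → Ω → Fin m) (B : ℕ → Fin n → Ω → Bool)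
    (xs : Vec d) (k : ℕ) (ω : Ω) : ℝ :=
  refVariance F xs (fun i => refPoint F γ τ x0 w0 J B k i ω)

/-! ### The parametric assumptions on a local stochastic first-order method

They are predicates of local objectives `f`, a point `xs`, random local iterates `x`, random
local directions `g` and a random sequence `σsq`. -/

/-- Constants of the moment bounds. -/
structure MomentConstants where
  A : ℝ
  B : ℝ
  F : ℝ
  D₁ : ℝ
  A' : ℝ
  B' : ℝ
  F' : ℝ
  D₁' : ℝ
  ρ : ℝ
  C : ℝ
  G : ℝ
  D₂ : ℝ

/-- All the constants are nonnegative and `ρ ∈ (0, 1]`. -/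
structure MomentConstants.Admissible (c : MomentConstants) : Prop where
  A_nonneg : 0 ≤ c.A
  B_nonneg : 0 ≤ c.B
  F_nonneg : 0 ≤ c.F
  D₁_nonneg : 0 ≤ c.D₁
  A'_nonneg : 0 ≤ c.A'
  B'_nonneg : 0 ≤ c.B'
  F'_nonneg : 0 ≤ c.F'
  D₁'_nonneg : 0 ≤ c.D₁'
  ρ_pos : 0 < c.ρ
  ρ_le_one : c.ρ ≤ 1
  C_nonneg : 0 ≤ c.C
  G_nonneg : 0 ≤ c.G
  D₂_nonneg : 0 ≤ c.D₂

/-- The bounds on the second moments of the local directions and of their mean, and the recursion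
for `σ_k²`, for all `k ≥ 0`; all the expectations that occur are those of integrable functions. -/
structure MomentBounds {Ω : Type*} [MeasurableSpace Ω] (P : Measure Ω) {d n : ℕ}
    (f : Fin n → Vec d → ℝ) (xs : Vec d) (x g : ℕ → Fin n → Ω → Vec d) (σsq : ℕ → Ω → ℝ)
    (c : MomentConstants) : Prop where
  admissible : c.Admissible
  sigma_nonneg : ∀ k ω, 0 ≤ σsq k ω
  integrable_obj : ∀ k, Integrable (fun ω => globalObj f (mean fun i => x k i ω)) P
  integrable_sigma : ∀ k, Integrable (σsq k) P
  integrable_V : ∀ k, Integrable (fun ω => discrepancy fun i => x k i ω) P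
  integrable_grad_sq : ∀ k i, Integrable (fun ω => ‖g k i ω‖ ^ 2) P
  integrable_mean_sq : ∀ k, Integrable (fun ω => ‖mean fun i => g k i ω‖ ^ 2) P
  second_moment : ∀ k,
    (1 / (n : ℝ)) * ∑ i, ∫ ω, ‖g k i ω‖ ^ 2 ∂P ≤
      2 * c.A * ∫ ω, (globalObj f (mean fun i => x k i ω) - globalObj f xs) ∂P
        + c.B * ∫ ω, σsq k ω ∂P
        + c.F * ∫ ω, discrepancy (fun i => x k i ω) ∂P + c.D₁
  second_moment_mean : ∀ k,
    ∫ ω, ‖mean fun i => g k i ω‖ ^ 2 ∂P ≤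
      2 * c.A' * ∫ ω, (globalObj f (mean fun i => x k i ω) - globalObj f xs) ∂P
        + c.B' * ∫ ω, σsq k ω ∂P
        + c.F' * ∫ ω, discrepancy (fun i => x k i ω) ∂P + c.D₁'
  sigma_recursion : ∀ k,
    ∫ ω, σsq (k + 1) ω ∂P ≤
      (1 - c.ρ) * ∫ ω, σsq k ω ∂P
        + 2 * c.C * ∫ ω, (globalObj f (mean fun i => x k i ω) - globalObj f xs) ∂P
        + c.G * ∫ ω, discrepancy (fun i => x k i ω) ∂P + c.D₂

/-- The key parametric assumption: unbiasedness of the mean direction, conditionally on the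
randomness `past k` of the iterations before `k`, the moment bounds, and the bound on the weighted
sum of the discrepancies with constants `H` and `D₃`. -/
structure KeyAssumption {Ω : Type*} [MeasurableSpace Ω] (P : Measure Ω) {d n : ℕ}
    (f : Fin n → Vec d → ℝ) (xs : Vec d) (x g : ℕ → Fin n → Ω → Vec d) (σsq : ℕ → Ω → ℝ)
    (past : ℕ → MeasurableSpace Ω) (L μ γ : ℝ) (c : MomentConstants) (H D₃ : ℝ) : Prop
    extends MomentBounds P f xs x g σsq c where
  H_nonneg : 0 ≤ H
  D₃_nonneg : 0 ≤ D₃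
  unbiased : ∀ k,
    P[fun ω => mean fun i => g k i ω | past k] =ᵐ[P]
      fun ω => mean fun i => ∇ (f i) (x k i ω)
  sum_discrepancy : ∀ K : ℕ,
    2 * L * ∑ k ∈ Finset.range (K + 1),
        weight γ μ c.ρ k * ∫ ω, discrepancy (fun i => x k i ω) ∂P ≤
      (1 / 2) * ∑ k ∈ Finset.range (K + 1), weight γ μ c.ρ k *
          ∫ ω, (globalObj f (mean fun i => x k i ω) - globalObj f xs) ∂P
        + 2 * L * H * ∫ ω, σsq 0 ω ∂P
        + 2 * L * D₃ * γ ^ 2 * weightSum γ μ c.ρ K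

/-- Constants of the separate bounds on the conditional mean (suffix `t`, for a tilde) and on the
conditional variance (suffix `h`, for a hat) of the local directions. -/
structure HeteroConstants where
  At : ℝ
  Ah : ℝ
  Bt : ℝ
  Bh : ℝ
  Ft : ℝ
  Fh : ℝ
  D₁t : ℝ
  D₁h : ℝ

/-- All the constants are nonnegative. -/
structure HeteroConstants.Admissible (c : HeteroConstants) : Prop where
  At_nonneg : 0 ≤ c.At
  Ah_nonneg : 0 ≤ c.Ah
  Bt_nonneg : 0 ≤ c.Bt
  Bh_nonneg : 0 ≤ c.Bh
  Ft_nonneg : 0 ≤ c.Ft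
  Fh_nonneg : 0 ≤ c.Fh
  D₁t_nonneg : 0 ≤ c.D₁t
  D₁h_nonneg : 0 ≤ c.D₁h

/-- The conditional mean `E[g_i^k | x_1^k, …, x_n^k]` of a local direction. -/
def condMean {Ω : Type*} [MeasurableSpace Ω] (P : Measure Ω) {d n : ℕ}
    (x g : ℕ → Fin n → Ω → Vec d) (k : ℕ) (i : Fin n) : Ω → Vec d :=
  P[g k i | MeasurableSpace.comap (fun ω : Ω => (fun l => x k l ω : Fin n → Vec d)) inferInstance]

/-- The assumption for heterogeneous data: the moment bounds, together with separate bounds on the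
conditional means and on the conditional variances of the local directions. -/
structure HeteroAssumption {Ω : Type*} [MeasurableSpace Ω] (P : Measure Ω) {d n : ℕ}
    (f : Fin n → Vec d → ℝ) (xs : Vec d) (x g : ℕ → Fin n → Ω → Vec d) (σsq : ℕ → Ω → ℝ)
    (c : MomentConstants) (h : HeteroConstants) : Prop
    extends MomentBounds P f xs x g σsq c where
  hetero_admissible : h.Admissible
  integrable_cond_mean_sq : ∀ k i, Integrable (fun ω => ‖condMean P x g k i ω‖ ^ 2) P
  integrable_cond_dev_sq : ∀ k i,
    Integrable (fun ω => ‖g k i ω - condMean P x g k i ω‖ ^ 2) P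
  cond_mean : ∀ k,
    (1 / (n : ℝ)) * ∑ i, ∫ ω, ‖condMean P x g k i ω‖ ^ 2 ∂P ≤
      2 * h.At * ∫ ω, (globalObj f (mean fun i => x k i ω) - globalObj f xs) ∂P
        + h.Bt * ∫ ω, σsq k ω ∂P
        + h.Ft * ∫ ω, discrepancy (fun i => x k i ω) ∂P + h.D₁t
  cond_variance : ∀ k,
    (1 / (n : ℝ)) * ∑ i, ∫ ω, ‖g k i ω - condMean P x g k i ω‖ ^ 2 ∂P ≤
      2 * h.Ah * ∫ ω, (globalObj f (mean fun i => x k i ω) - globalObj f xs) ∂P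
        + h.Bh * ∫ ω, σsq k ω ∂P
        + h.Fh * ∫ ω, discrepancy (fun i => x k i ω) ∂P + h.D₁h

/-! ### The constants of Local-SVRG

Here `M` stands for `max L_{ij}`, a common smoothness constant of all the `f_{ij}`, and `z` stands
for `ζ_*²`. -/

/-- Constants of the separate bounds on conditional mean and variance. -/
def svrgHetero (L M z : ℝ) : HeteroConstants where
  At := 3 * L
  Ah := 4 * M
  Bt := 0
  Bh := 1 / 2
  Ft := 3 * L ^ 2
  Fh := 4 * L * M
  D₁t := 3 * z
  D₁h := 0

/-- Constants of the moment bounds. The constants `A`, `B`, `F`, `D₁` of the second moment are the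
sums of those for the conditional mean and the conditional variance. -/
def svrgMoment (n : ℕ) (L M q z : ℝ) : MomentConstants where
  A := 3 * L + 4 * M
  B := 1 / 2
  F := 3 * L ^ 2 + 4 * L * M
  D₁ := 3 * z
  A' := 4 * M / n + L
  B' := 1 / n
  F' := 4 * L * M / n + 2 * L ^ 2
  D₁' := 0
  ρ := q
  C := 8 * q * M
  G := 8 * q * L * M
  D₂ := 0

/-- `H = 2e(τ-1)(2+q)γ²/q`. -/
def svrgH (τ : ℕ) (q γ : ℝ) : ℝ :=
  2 * Real.exp 1 * ((τ : ℝ) - 1) * (2 + q) * γ ^ 2 / q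

/-- `D₃ = 6e(τ-1)²ζ_*²`. -/
def svrgD₃ (τ : ℕ) (z : ℝ) : ℝ :=
  6 * Real.exp 1 * ((τ : ℝ) - 1) ^ 2 * z

/-- `Φ⁰ = 2‖x⁰ - x^*‖² + (8/(3nq)) γ² σ₀² + (8eL(τ-1)(2+q)γ³/q) σ₀²`, where `R` is `‖x⁰ - x^*‖`
and `s` is `σ₀²`. -/
def Phi0 (n τ : ℕ) (L q γ R s : ℝ) : ℝ :=
  2 * R ^ 2 + 8 / (3 * n * q) * γ ^ 2 * s
    + 8 * Real.exp 1 * L * ((τ : ℝ) - 1) * (2 + q) * γ ^ 3 / q * s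

/-- The stepsize bounds
`γ ≤ 1/(2(44M/n + L))` and
`γ ≤ 1/(4 √(2eL(τ-1)(3L(τ-1) + 4M + 8M/(1-q))))`,
multiplied by their denominators, so that a bound with vanishing denominator (as the second one
for `τ = 1`) is no restriction. -/
def StepsizeOK (n τ : ℕ) (L M q γ : ℝ) : Prop :=
  γ * (2 * (44 * M / n + L)) ≤ 1 ∧
  γ * (4 * Real.sqrt (2 * Real.exp 1 * L * ((τ : ℝ) - 1) *
    (3 * L * ((τ : ℝ) - 1) + 4 * M + 8 * M / (1 - q)))) ≤ 1

end

end LocalSVRG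

open LocalSVRG

namespace LocalSVRG

open scoped RealInnerProductSpace

/-! ### Smooth convex functions -/

/-! Write R, r, s, V for the expectations in iteration k of the squared distance of the mean iterate
to `xs`, its suboptimality, σ² and the discrepancy. Averaging the local steps leaves the mean
unchanged, so in every iteration the mean iterate takes an SGD step with inexact gradients, which
are evaluated at the local iterates instead of at the mean. Smoothness and convexity convert this
inexactness into multiples of V (`le_inner_mean_gradient`, `norm_mean_gradient_sq_le`,
`bregman_le_two_mul_bregman`), while cocoercivity bounds the sampling variance by suboptimality, σ²
and V (`discrepancy_direction_le`). Independence of the nodes divides that variance by n in the mean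
direction.

The function R + c s, with c a suitable multiple of γ²/(nq), contracts by 1 - min {γμ, q/4} and
gains -γ r + 2γL V. Summing with the weights, which undo the contraction, leaves only the weighted
sum of V to control (`Setting.sum_gap_le`).

V vanishes at each communication. In between, the mean gradients inflate it through Young's
inequality with parameter 1/(τ-1), but the centred noise just adds its variance; unrolling over
fewer than τ steps therefore costs only a factor e (`le_sum_Ico_of_recursion`). The weights vary
little over such a window, the weighted sum of s follows from its own recursion, and the second
stepsize bound makes the coefficients of r and V small enough to be absorbed
(`sum_weight_discrepancy_le`). Jensen's inequality and lower bounds for the sum of the weights give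
the final rates.

On the probabilistic side, the state is a function of finitely many finitely valued choices
(`exists_state_eq`), so integrability is automatic, and every expectation reduces by Fubini to an
average over the current choices at a frozen state (`IsSampling.integral_eq`). -/

/-- The Bregman divergence `h x - h y - ⟪∇ h y, x - y⟫`. -/
noncomputable def bregman {d : ℕ} (h : Vec d → ℝ) (x y : Vec d) : ℝ :=
  h x - h y - ⟪∇ h y, x - y⟫

section Single

variable {d : ℕ} {h : Vec d → ℝ} {L μ : ℝ}

lemma hasDerivAt_comp_line (hd : Differentiable ℝ h) (x v : Vec d) (t : ℝ) :
    HasDerivAt (fun s : ℝ => h (x + s • v)) ⟪∇ h (x + t • v), v⟫ t := by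
  have h1 : HasDerivAt (fun s : ℝ => x + s • v) v t := by
    simpa using ((hasDerivAt_id t).smul_const v).const_add x
  have h2 := ((hd (x + t • v)).hasGradientAt.hasFDerivAt).comp_hasDerivAt t h1
  exact h2.congr_deriv (InnerProductSpace.toDual_apply_apply ..)

/-- Along the segment, `h` minus its quadratic majorant has nonpositive derivative, by
Cauchy-Schwarz and the Lipschitz bound on the gradient. -/
lemma IsSmooth.le_quadratic (hs : IsSmooth L h) (x y : Vec d) :
    h y ≤ h x + ⟪∇ h x, y - x⟫ + L / 2 * ‖y - x‖ ^ 2 := by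
  set v := y - x with hv
  let ψ : ℝ → ℝ := fun t => h (x + t • v) - t * ⟪∇ h x, v⟫ - L / 2 * ‖v‖ ^ 2 * t ^ 2
  have hder : ∀ t, HasDerivAt ψ
      (⟪∇ h (x + t • v), v⟫ - ⟪∇ h x, v⟫ - L * ‖v‖ ^ 2 * t) t := fun t => by
    have h1 := ((hasDerivAt_comp_line hs.1 x v t).sub
      ((hasDerivAt_id t).mul_const ⟪∇ h x, v⟫)).sub
      ((hasDerivAt_pow 2 t).const_mul (L / 2 * ‖v‖ ^ 2))
    refine h1.congr_deriv ?_
    simp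
    ring
  have hanti : AntitoneOn ψ (Set.Icc 0 1) := by
    refine antitoneOn_of_deriv_nonpos (convex_Icc 0 1)
      (fun t _ => (hder t).continuousAt.continuousWithinAt)
      (fun t _ => (hder t).differentiableAt.differentiableWithinAt) fun t ht => ?_
    rw [interior_Icc] at ht
    rw [(hder t).deriv, ← inner_sub_left]
    have h1 := real_inner_le_norm (∇ h (x + t • v) - ∇ h x) v
    have h2 := hs.2 (x + t • v) x
    have h3 : ‖x + t • v - x‖ = t * ‖v‖ := by
      rw [add_sub_cancel_left, norm_smul, Real.norm_of_nonneg ht.1.le]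
    rw [h3] at h2
    nlinarith [mul_le_mul_of_nonneg_right h2 (norm_nonneg v)]
  have h4 := hanti (Set.left_mem_Icc.2 zero_le_one) (Set.right_mem_Icc.2 zero_le_one) zero_le_one
  simp only [ψ, one_smul, zero_smul, hv, add_sub_cancel, add_zero] at h4
  linarith

/-- Strong convexity bounds the difference quotient of `h` at `x` towards `y`; the gradient
inequality is its limit as the step tends to 0 from the right. -/
lemma le_of_strongConvexOn (hd : Differentiable ℝ h) (hc : StrongConvexOn Set.univ μ h)
    (x y : Vec d) : h x + ⟪∇ h x, y - x⟫ + μ / 2 * ‖y - x‖ ^ 2 ≤ h y := by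
  have h1 := (hasDerivAt_comp_line hd x (y - x) 0).tendsto_slope_zero_right
  simp only [zero_add, zero_smul, add_zero] at h1
  have h2 : Filter.Tendsto (fun t : ℝ => h y - h x - (1 - t) * (μ / 2 * ‖y - x‖ ^ 2))
      (nhdsWithin 0 (Set.Ioi 0)) (nhds (h y - h x - (1 - 0) * (μ / 2 * ‖y - x‖ ^ 2))) :=
    (Continuous.tendsto (by fun_prop) 0).mono_left nhdsWithin_le_nhds
  have h3 := le_of_tendsto_of_tendsto h1 h2 ?_
  · linarith
  · filter_upwards [Ioo_mem_nhdsGT (zero_lt_one' ℝ)] with t ht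
    have h4 := hc.2 (Set.mem_univ x) (Set.mem_univ y) (sub_nonneg.2 ht.2.le) ht.1.le (by ring)
    have h5 : (1 - t) • x + t • y = x + t • (y - x) := by module
    rw [h5] at h4
    simp only [smul_eq_mul] at h4 ⊢
    rw [inv_mul_le_iff₀ ht.1, norm_sub_rev y x]
    linarith

lemma le_of_convexOn (hd : Differentiable ℝ h) (hc : ConvexOn ℝ Set.univ h)
    (x y : Vec d) : h x + ⟪∇ h x, y - x⟫ ≤ h y := by
  simpa using le_of_strongConvexOn hd (strongConvexOn_zero.2 hc) x y

lemma bregman_nonneg (hd : Differentiable ℝ h) (hc : ConvexOn ℝ Set.univ h) (x y : Vec d) :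
    0 ≤ bregman h x y := by
  have := le_of_convexOn hd hc y x
  unfold bregman
  linarith

/-- Cocoercivity of the gradient of a smooth convex function. -/
lemma IsSmooth.norm_gradient_sub_sq_le (hL : 0 ≤ L) (hs : IsSmooth L h)
    (hc : ConvexOn ℝ Set.univ h) (x y : Vec d) :
    ‖∇ h x - ∇ h y‖ ^ 2 ≤ 2 * L * bregman h x y := by
  -- The trial step below has length 1/L; for `L = 0` the gradient is constant and both sides
  -- vanish.
  rcases hL.eq_or_lt with rfl | hL
  · have := hs.2 x y
    have h0 : ‖∇ h x - ∇ h y‖ = 0 := le_antisymm (by simpa using this) (norm_nonneg _)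
    simp [h0]
  · set v := ∇ h x - ∇ h y with hv
    -- The value at the trial point `x - L⁻¹ • v` is bounded above by smoothness at `x` and below by
    -- convexity at `y`.
    have h1 := hs.le_quadratic x (x - L⁻¹ • v)
    have h2 := le_of_convexOn hs.1 hc y (x - L⁻¹ • v)
    have e1 : x - L⁻¹ • v - x = -(L⁻¹ • v) := by abel
    have e2 : x - L⁻¹ • v - y = (x - y) - L⁻¹ • v := by abel
    have e3 : ⟪∇ h x, v⟫ - ⟪∇ h y, v⟫ = ‖v‖ ^ 2 := by
      rw [← inner_sub_left, ← hv, real_inner_self_eq_norm_sq]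
    rw [e1, norm_neg, inner_neg_right, norm_smul, Real.norm_of_nonneg (by positivity),
      real_inner_smul_right] at h1
    rw [e2, inner_sub_right, real_inner_smul_right] at h2
    have h3 : L / 2 * (L⁻¹ * ‖v‖) ^ 2 = L⁻¹ / 2 * ‖v‖ ^ 2 := by field_simp
    have h4 : L⁻¹ / 2 * ‖v‖ ^ 2 ≤ bregman h x y := by
      unfold bregman
      rw [h3] at h1
      have : L⁻¹ * ⟪∇ h x, v⟫ - L⁻¹ * ⟪∇ h y, v⟫ = L⁻¹ * ‖v‖ ^ 2 := by rw [← e3]; ring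
      linarith
    calc ‖v‖ ^ 2 = 2 * L * (L⁻¹ / 2 * ‖v‖ ^ 2) := by field_simp
      _ ≤ _ := by gcongr

/-- The two quadratic bounds at 0 are compared at a nonzero point. In dimension 0 there is no such
point, and every function is strongly convex with any modulus. -/
lemma le_of_strongConvexOn_of_isSmooth [Nontrivial (Vec d)]
    (hs : IsSmooth L h) (hc : StrongConvexOn Set.univ μ h) : μ ≤ L := by
  obtain ⟨y, hy⟩ := exists_ne (0 : Vec d)
  have h1 := hs.le_quadratic 0 y
  have h2 := le_of_strongConvexOn hs.1 hc 0 y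
  have h3 : 0 < ‖y - 0‖ ^ 2 := by simpa using pow_pos (norm_pos_iff.2 hy) 2
  by_contra! h4
  nlinarith

end Single

/-! ### Gradients of averages -/

section Averages

variable {d n m : ℕ}

lemma hasGradientAt_average {ι : Type*} [Fintype ι] (c : ℝ) {g : ι → Vec d → ℝ}
    (hg : ∀ i, Differentiable ℝ (g i)) (x : Vec d) :
    HasGradientAt (fun x => c * ∑ i, g i x) (c • ∑ i, ∇ (g i) x) x := by
  rw [hasGradientAt_iff_hasFDerivAt]
  have h1 := (HasFDerivAt.fun_sum (u := Finset.univ)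
    fun i _ => ((hg i) x).hasGradientAt.hasFDerivAt).const_mul c
  refine h1.congr_fderiv ?_
  simp only [map_smulₛₗ, map_sum]
  simp

lemma gradient_localObj {F : Fin n → Fin m → Vec d → ℝ}
    (hF : ∀ i j, Differentiable ℝ (F i j)) (i : Fin n) (x : Vec d) :
    ∇ (localObj F i) x = (1 / (m : ℝ)) • ∑ j, ∇ (F i j) x :=
  (hasGradientAt_average _ (hF i) x).gradient

lemma sum_bregman_localObj {F : Fin n → Fin m → Vec d → ℝ}
    (hF : ∀ i j, Differentiable ℝ (F i j)) (i : Fin n) (x y : Vec d) :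
    (1 / (m : ℝ)) * ∑ j, bregman (F i j) x y = bregman (localObj F i) x y := by
  simp only [bregman, gradient_localObj hF, localObj, Finset.sum_sub_distrib,
    real_inner_smul_left, sum_inner]
  ring

lemma sum_gradient_eq_zero_of_isMinOn (hn : 0 < n) {f : Fin n → Vec d → ℝ}
    (hf : ∀ i, Differentiable ℝ (f i)) {xs : Vec d}
    (hxs : IsMinOn (globalObj f) Set.univ xs) : ∑ i, ∇ (f i) xs = 0 := by
  have h1 := (hasGradientAt_average (1 / (n : ℝ)) hf xs).hasFDerivAt
  have h2 : IsLocalMin (globalObj f) xs := hxs.isLocalMin Filter.univ_mem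
  have h3 := h2.hasFDerivAt_eq_zero h1
  have h4 : (1 / (n : ℝ)) • ∑ i, ∇ (f i) xs = 0 :=
    (InnerProductSpace.toDual ℝ (Vec d)).map_eq_zero_iff.1 h3
  have : (1 / (n : ℝ)) ≠ 0 := by positivity
  exact (smul_eq_zero.1 h4).resolve_left this

end Averages

/-! ### Averages over the nodes -/

/-- The average `(1/n) ∑_i a_i`. -/
noncomputable def avg {n : ℕ} (a : Fin n → ℝ) : ℝ :=
  (1 / (n : ℝ)) * ∑ i, a i

section Avg

variable {d n : ℕ}

lemma avg_mono {a b : Fin n → ℝ} (h : ∀ i, a i ≤ b i) : avg a ≤ avg b :=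
  mul_le_mul_of_nonneg_left (Finset.sum_le_sum fun i _ => h i) (by positivity)

lemma avg_nonneg {a : Fin n → ℝ} (h : ∀ i, 0 ≤ a i) : 0 ≤ avg a :=
  mul_nonneg (by positivity) (Finset.sum_nonneg fun i _ => h i)

lemma avg_add (a b : Fin n → ℝ) : avg (fun i => a i + b i) = avg a + avg b := by
  simp only [avg, Finset.sum_add_distrib, mul_add]

lemma avg_sub (a b : Fin n → ℝ) : avg (fun i => a i - b i) = avg a - avg b := by
  simp only [avg, Finset.sum_sub_distrib, mul_sub]

lemma avg_mul_left (c : ℝ) (a : Fin n → ℝ) : avg (fun i => c * a i) = c * avg a := by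
  simp only [avg, ← Finset.mul_sum]
  ring

lemma avg_const (hn : 0 < n) (c : ℝ) : avg (fun _ : Fin n => c) = c := by
  have : (n : ℝ) ≠ 0 := by positivity
  simp [avg, this]

lemma avg_inner_left (v : Vec d) (y : Fin n → Vec d) :
    avg (fun i => ⟪v, y i⟫) = ⟪v, mean y⟫ := by
  simp only [avg, mean, real_inner_smul_right, inner_sum]

lemma avg_inner_right (v : Vec d) (y : Fin n → Vec d) :
    avg (fun i => ⟪y i, v⟫) = ⟪mean y, v⟫ := by
  simp only [avg, mean, real_inner_smul_left, sum_inner]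

lemma mean_add (y z : Fin n → Vec d) : mean (fun i => y i + z i) = mean y + mean z := by
  simp only [mean, Finset.sum_add_distrib, smul_add]

lemma mean_sub (y z : Fin n → Vec d) : mean (fun i => y i - z i) = mean y - mean z := by
  simp only [mean, Finset.sum_sub_distrib, smul_sub]

lemma mean_smul (c : ℝ) (y : Fin n → Vec d) : mean (fun i => c • y i) = c • mean y := by
  simp only [mean, ← Finset.smul_sum]
  rw [smul_comm]

lemma mean_const (hn : 0 < n) (v : Vec d) : mean (fun _ : Fin n => v) = v := by
  have : (n : ℝ) ≠ 0 := by positivity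
  simp [mean, ← Nat.cast_smul_eq_nsmul ℝ, smul_smul, this]

lemma avg_inner_sub_mean (hn : 0 < n) (v : Vec d) (y : Fin n → Vec d) :
    avg (fun i => ⟪v, y i - mean y⟫) = 0 := by
  rw [avg_inner_left, mean_sub, mean_const hn, sub_self, inner_zero_right]

/-- The average of the squared distances to a point splits into squared bias and discrepancy. -/
lemma avg_norm_sub_sq (hn : 0 < n) (y : Fin n → Vec d) (v : Vec d) :
    avg (fun i => ‖y i - v‖ ^ 2) = ‖mean y - v‖ ^ 2 + discrepancy y := by
  have h1 : ∀ i, ‖y i - v‖ ^ 2 =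
      ‖mean y - v‖ ^ 2 + 2 * ⟪mean y - v, y i - mean y⟫ + ‖y i - mean y‖ ^ 2 := fun i => by
    rw [← norm_add_sq_real]
    congr 2
    abel
  simp only [h1, avg_add, avg_mul_left, avg_inner_sub_mean hn, avg_const hn]
  simp only [mul_zero, add_zero]
  rfl

lemma discrepancy_nonneg (y : Fin n → Vec d) : 0 ≤ discrepancy y :=
  avg_nonneg fun _ => sq_nonneg _

lemma discrepancy_le (hn : 0 < n) (y : Fin n → Vec d) :
    discrepancy y ≤ avg fun i => ‖y i‖ ^ 2 := by
  have := avg_norm_sub_sq hn y 0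
  simp only [sub_zero] at this
  rw [this]
  linarith [sq_nonneg ‖mean y‖]

end Avg

/-! ### Inequalities for a family of smooth convex functions -/

section Family

variable {d n : ℕ} {f : Fin n → Vec d → ℝ} {L μ : ℝ} {xs : Vec d}

/-- Young's inequality for √(2LD)‖b‖, in a form without division by `L` so that `L = 0` is covered.
-/
lemma inner_le_add_of_norm_sq_le {a b : Vec d} {D : ℝ} (hL : 0 ≤ L) (hD : 0 ≤ D)
    (h : ‖a‖ ^ 2 ≤ 2 * L * D) : ⟪a, b⟫ ≤ D + L / 2 * ‖b‖ ^ 2 := by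
  refine (real_inner_le_norm a b).trans (abs_le_of_sq_le_sq' ?_ (by positivity)).2
  have h1 := mul_le_mul_of_nonneg_right h (sq_nonneg ‖b‖)
  nlinarith [sq_nonneg (D - L / 2 * ‖b‖ ^ 2)]

/-- Moving the first argument from `y` to `x` costs a linear term in ∇h(y) - ∇h(z), which
cocoercivity and Young absorb into a second copy of the divergence at `y`. This transfers bounds
from the local iterates to their mean. -/
lemma bregman_le_two_mul_bregman {h : Vec d → ℝ} (hL : 0 ≤ L) (hs : IsSmooth L h)
    (hc : ConvexOn ℝ Set.univ h) (x y z : Vec d) :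
    bregman h x z ≤ 2 * bregman h y z + L * ‖x - y‖ ^ 2 := by
  have h1 := hs.le_quadratic y x
  have h2 := inner_le_add_of_norm_sq_le (b := x - y) hL (bregman_nonneg hs.1 hc y z)
    (hs.norm_gradient_sub_sq_le hL hc y z)
  have h3 : ⟪∇ h z, x - z⟫ = ⟪∇ h z, x - y⟫ + ⟪∇ h z, y - z⟫ := by
    rw [← inner_add_right, sub_add_sub_cancel]
  rw [inner_sub_left] at h2
  unfold bregman at h2 ⊢
  linarith

/-- The local gradients at `xs` need not vanish, but their mean does, so the linear terms cancel on
averaging. -/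
lemma avg_bregman_eq (hn : 0 < n) (hf : ∀ i, Differentiable ℝ (f i))
    (hxs : IsMinOn (globalObj f) Set.univ xs) (z : Vec d) :
    avg (fun i => bregman (f i) z xs) = globalObj f z - globalObj f xs := by
  have h1 : mean (fun i => ∇ (f i) xs) = 0 := by
    simp [mean, sum_gradient_eq_zero_of_isMinOn hn hf hxs]
  simp only [bregman, avg_sub, avg_inner_right, h1, inner_zero_left, sub_zero]
  rfl

lemma avg_bregman_le (hn : 0 < n) (hL : 0 ≤ L) (hs : ∀ i, IsSmooth L (f i))
    (hc : ∀ i, ConvexOn ℝ Set.univ (f i)) (hxs : IsMinOn (globalObj f) Set.univ xs)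
    (y : Fin n → Vec d) :
    avg (fun i => bregman (f i) (y i) xs) ≤
      2 * (globalObj f (mean y) - globalObj f xs) + L * discrepancy y := by
  refine (avg_mono fun i =>
    bregman_le_two_mul_bregman hL (hs i) (hc i) (y i) (mean y) xs).trans_eq ?_
  rw [avg_add, avg_mul_left, avg_mul_left, avg_bregman_eq hn (fun i => (hs i).1) hxs]
  rfl

lemma norm_add_add_sq_le (a b c : Vec d) :
    ‖a + b + c‖ ^ 2 ≤ 3 * ‖a‖ ^ 2 + 3 * ‖b‖ ^ 2 + 3 * ‖c‖ ^ 2 := by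
  have h1 := norm_add₃_le (a := a) (b := b) (c := c)
  have h2 := pow_le_pow_left₀ (norm_nonneg _) h1 2
  nlinarith [sq_nonneg (‖a‖ - ‖b‖), sq_nonneg (‖b‖ - ‖c‖), sq_nonneg (‖a‖ - ‖c‖)]

/-- The gradient is split through the points `mean y` and `xs`: the Lipschitz bound gives the
discrepancy, cocoercivity the suboptimality, and the remainder is the heterogeneity. -/
lemma avg_norm_gradient_sq_le (hn : 0 < n) (hL : 0 ≤ L) (hs : ∀ i, IsSmooth L (f i))
    (hc : ∀ i, ConvexOn ℝ Set.univ (f i)) (hxs : IsMinOn (globalObj f) Set.univ xs)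
    (y : Fin n → Vec d) :
    avg (fun i => ‖∇ (f i) (y i)‖ ^ 2) ≤
      6 * L * (globalObj f (mean y) - globalObj f xs) + 3 * L ^ 2 * discrepancy y
        + 3 * zetaStarSq f xs := by
  have h1 : ∀ i, ‖∇ (f i) (y i)‖ ^ 2 ≤ 3 * L ^ 2 * ‖y i - mean y‖ ^ 2
      + 6 * L * bregman (f i) (mean y) xs + 3 * ‖∇ (f i) xs‖ ^ 2 := fun i => by
    have h2 := norm_add_add_sq_le (∇ (f i) (y i) - ∇ (f i) (mean y))
      (∇ (f i) (mean y) - ∇ (f i) xs) (∇ (f i) xs)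
    have h3 := pow_le_pow_left₀ (norm_nonneg _) ((hs i).2 (y i) (mean y)) 2
    have h4 := (hs i).norm_gradient_sub_sq_le hL (hc i) (mean y) xs
    rw [sub_add_sub_cancel, sub_add_cancel] at h2
    rw [mul_pow] at h3
    linarith
  refine (avg_mono h1).trans_eq ?_
  rw [avg_add, avg_add, avg_mul_left, avg_mul_left, avg_mul_left,
    avg_bregman_eq hn (fun i => (hs i).1) hxs]
  unfold zetaStarSq discrepancy avg
  ring

/-- A step of length 1/L from `mean y` along the mean gradient cannot go below the minimum. Each
local objective is expanded at its own `y i`, and the cross terms with `y i - mean y` average to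
zero. No heterogeneity term appears, since only the mean gradient is estimated. -/
lemma norm_mean_gradient_sq_le (hn : 0 < n) (hL : 0 ≤ L) (hs : ∀ i, IsSmooth L (f i))
    (hc : ∀ i, ConvexOn ℝ Set.univ (f i)) (hxs : IsMinOn (globalObj f) Set.univ xs)
    (y : Fin n → Vec d) :
    ‖mean fun i => ∇ (f i) (y i)‖ ^ 2 ≤
      2 * L * (globalObj f (mean y) - globalObj f xs) + L ^ 2 * discrepancy y := by
  rcases hL.eq_or_lt with rfl | hL
  · have h1 : ∀ i, ∇ (f i) (y i) = ∇ (f i) xs := fun i => by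
      have := (hs i).2 (y i) xs
      rw [zero_mul] at this
      exact sub_eq_zero.1 (norm_eq_zero.1 (le_antisymm this (norm_nonneg _)))
    simp [h1, mean, sum_gradient_eq_zero_of_isMinOn hn (fun i => (hs i).1) hxs]
  · set g := mean fun i => ∇ (f i) (y i) with hg
    have h1 : ∀ i, f i (mean y - L⁻¹ • g) ≤ f i (mean y) - L⁻¹ * ⟪∇ (f i) (y i), g⟫
        + (L / 2 * ‖y i - mean y‖ ^ 2 + ⟪g, y i - mean y⟫ + L⁻¹ / 2 * ‖g‖ ^ 2) := fun i => by
      have h2 := (hs i).le_quadratic (y i) (mean y - L⁻¹ • g)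
      have h3 := le_of_convexOn (hs i).1 (hc i) (y i) (mean y)
      have e1 : mean y - L⁻¹ • g - y i = (mean y - y i) - L⁻¹ • g := by abel
      have e2 : L / 2 * ‖mean y - L⁻¹ • g - y i‖ ^ 2 =
          L / 2 * ‖y i - mean y‖ ^ 2 + ⟪g, y i - mean y⟫ + L⁻¹ / 2 * ‖g‖ ^ 2 := by
        rw [show mean y - L⁻¹ • g - y i = -((y i - mean y) + L⁻¹ • g) by abel, norm_neg,
          norm_add_sq_real, real_inner_smul_right, norm_smul, Real.norm_of_nonneg (by positivity),
          real_inner_comm]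
        field_simp
      rw [e2, e1, inner_sub_right, real_inner_smul_right] at h2
      linarith
    have h4 := avg_mono h1
    simp only [avg_add, avg_sub, avg_mul_left, avg_inner_right, avg_inner_sub_mean hn,
      avg_const hn] at h4
    rw [← hg, real_inner_self_eq_norm_sq] at h4
    have h5 : globalObj f xs ≤ avg fun i => f i (mean y - L⁻¹ • g) :=
      hxs (Set.mem_univ (mean y - L⁻¹ • g))
    change _ ≤ globalObj f (mean y) - L⁻¹ * ‖g‖ ^ 2
      + (L / 2 * discrepancy y + 0 + L⁻¹ / 2 * ‖g‖ ^ 2) at h4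
    have h6 : L⁻¹ / 2 * ‖g‖ ^ 2 ≤
        globalObj f (mean y) - globalObj f xs + L / 2 * discrepancy y := by linarith
    calc ‖g‖ ^ 2 = 2 * L * (L⁻¹ / 2 * ‖g‖ ^ 2) := by field_simp
      _ ≤ 2 * L * (globalObj f (mean y) - globalObj f xs + L / 2 * discrepancy y) := by gcongr
      _ = _ := by ring

/-- Going from `y i` to `mean y` uses smoothness, from `y i` to `xs` strong convexity. The average
of ‖y_i - xs‖² exceeds ‖mean y - xs‖² by the discrepancy, and this gain is dropped. -/
lemma le_inner_mean_gradient (hn : 0 < n) (hμ : 0 ≤ μ) (hs : ∀ i, IsSmooth L (f i))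
    (hc : ∀ i, StrongConvexOn Set.univ μ (f i)) (y : Fin n → Vec d) :
    globalObj f (mean y) - globalObj f xs + μ / 2 * ‖mean y - xs‖ ^ 2
        - L / 2 * discrepancy y ≤
      ⟪mean y - xs, mean fun i => ∇ (f i) (y i)⟫ := by
  have h1 : ∀ i, f i (mean y) - f i xs + μ / 2 * ‖y i - xs‖ ^ 2
      - L / 2 * ‖y i - mean y‖ ^ 2 ≤ ⟪mean y - xs, ∇ (f i) (y i)⟫ := fun i => by
    have h2 := (hs i).le_quadratic (y i) (mean y)
    have h3 := le_of_strongConvexOn (hs i).1 (hc i) (y i) xs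
    rw [norm_sub_rev] at h2 h3
    have h4 : ⟪mean y - xs, ∇ (f i) (y i)⟫ =
        ⟪∇ (f i) (y i), mean y - y i⟫ - ⟪∇ (f i) (y i), xs - y i⟫ := by
      rw [← inner_sub_right, sub_sub_sub_cancel_right, real_inner_comm]
    linarith
  have h5 := avg_mono h1
  simp only [avg_add, avg_sub, avg_mul_left, avg_inner_left, avg_norm_sub_sq hn y xs] at h5
  change globalObj f (mean y) - globalObj f xs + _ - L / 2 * discrepancy y ≤ _ at h5
  nlinarith [discrepancy_nonneg y]

end Family

/-! ### Finitely valued random variables -/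

section Finite

variable {Ω : Type*} [MeasurableSpace Ω] {P : Measure Ω} {E : Type*} [NormedAddCommGroup E]

lemma integrable_comp_of_finite [IsFiniteMeasure P] {α : Type*} [Finite α] [MeasurableSpace α]
    [MeasurableSingletonClass α] {Z : Ω → α} (hZ : Measurable Z) (φ : α → E) :
    Integrable (fun ω => φ (Z ω)) P :=
  (Integrable.of_finite (μ := P.map Z) (f := φ)).comp_measurable hZ

/-- Fubini for a function of two independent finitely valued random variables. -/
lemma IndepFun.integral_comp_eq [IsProbabilityMeasure P] [NormedSpace ℝ E]
    {α β : Type*} [Finite α] [MeasurableSpace α]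
    [MeasurableSingletonClass α] [Finite β] [MeasurableSpace β] [MeasurableSingletonClass β]
    {Z : Ω → α} {Y : Ω → β} (hZ : Measurable Z) (hY : Measurable Y) (h : IndepFun Z Y P)
    (φ : α → β → E) :
    ∫ ω, φ (Z ω) (Y ω) ∂P = ∫ ω, ∫ ω', φ (Z ω) (Y ω') ∂P ∂P := by
  have := Measure.isProbabilityMeasure_map (μ := P) hZ.aemeasurable
  have := Measure.isProbabilityMeasure_map (μ := P) hY.aemeasurable
  have h1 := (indepFun_iff_map_prod_eq_prod_map_map hZ.aemeasurable hY.aemeasurable).1 h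
  have hφ : Integrable (fun p : α × β => φ p.1 p.2) ((P.map Z).prod (P.map Y)) :=
    Integrable.of_finite
  have h2 : ∫ ω, φ (Z ω) (Y ω) ∂P =
      ∫ p, (fun p : α × β => φ p.1 p.2) p ∂(P.map fun ω => (Z ω, Y ω)) :=
    (integral_map (hZ.prodMk hY).aemeasurable (by rw [h1]; exact hφ.1)).symm
  have h3 : ∀ a, ∫ b, φ a b ∂(P.map Y) = ∫ ω', φ a (Y ω') ∂P := fun a =>
    integral_map hY.aemeasurable (Integrable.of_finite (f := φ a)).1
  rw [h2, h1, integral_prod _ hφ]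
  simp only [h3]
  exact integral_map hZ.aemeasurable
    (Integrable.of_finite (f := fun a => ∫ ω', φ a (Y ω') ∂P)).1

lemma integral_comp_of_uniform [IsFiniteMeasure P] [NormedSpace ℝ E] [CompleteSpace E]
    {m : ℕ} {j : Ω → Fin m}
    (hj : Measurable j) (hu : ∀ a, P.real {ω | j ω = a} = 1 / (m : ℝ)) (φ : Fin m → E) :
    ∫ ω, φ (j ω) ∂P = (1 / (m : ℝ)) • ∑ a, φ a := by
  have h1 : ∫ ω, φ (j ω) ∂P = ∫ a, φ a ∂(P.map j) :=
    (integral_map hj.aemeasurable (Integrable.of_finite (f := φ)).1).symm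
  rw [h1, integral_fintype Integrable.of_finite, Finset.smul_sum]
  refine Finset.sum_congr rfl fun a _ => ?_
  rw [map_measureReal_apply hj (measurableSet_singleton a), ← hu a]
  rfl

lemma integral_ite_coin [IsProbabilityMeasure P] {b : Ω → Bool} (hb : Measurable b) {q : ℝ}
    (hq : P.real {ω | b ω = true} = q) (u v : ℝ) :
    ∫ ω, (if b ω = true then u else v) ∂P = q * u + (1 - q) * v := by
  have hm : MeasurableSet {ω | b ω = true} := hb (measurableSet_singleton true)
  have h1 : ∀ ω, (if b ω = true then u else v) =
      Set.indicator {ω | b ω = true} (fun _ => u - v) ω + v := fun ω => by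
    by_cases h : b ω = true <;> simp [Set.indicator, h]
  simp only [h1]
  rw [integral_add ((integrable_const _).indicator hm) (integrable_const _),
    integral_indicator_const _ hm, hq]
  simp
  ring

end Finite

/-! ### Uniform independent sampling of one vector per node -/

/-- The discrepancy is a quadratic form. -/
lemma discrepancy_sub_smul {d n : ℕ} (hn : 0 < n) (u ξ : Fin n → Vec d) (γ : ℝ) :
    discrepancy (fun i => u i - γ • ξ i) =
      discrepancy u - 2 * γ * avg (fun i => ⟪u i - mean u, ξ i⟫) + γ ^ 2 * discrepancy ξ := by
  have h1 : ∀ i, ‖u i - γ • ξ i - mean (fun i => u i - γ • ξ i)‖ ^ 2 =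
      ‖u i - mean u‖ ^ 2 - 2 * γ * (⟪u i - mean u, ξ i⟫ - ⟪mean ξ, u i - mean u⟫)
        + γ ^ 2 * ‖ξ i - mean ξ‖ ^ 2 := fun i => by
    rw [mean_sub, mean_smul,
      show u i - γ • ξ i - (mean u - γ • mean ξ) = (u i - mean u) - γ • (ξ i - mean ξ) by module,
      norm_sub_sq_real, real_inner_smul_right, norm_smul, mul_pow, Real.norm_eq_abs, sq_abs,
      inner_sub_right, real_inner_comm (u i - mean u) (mean ξ)]
    ring
  change avg (fun i => ‖u i - γ • ξ i - mean (fun i => u i - γ • ξ i)‖ ^ 2) = _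
  simp only [h1, avg_add, avg_sub, avg_mul_left, avg_inner_sub_mean hn]
  rw [sub_zero]
  rfl

lemma discrepancy_sub_smul_le {d n : ℕ} (hn : 0 < n) (u ξ : Fin n → Vec d) (γ : ℝ) {β : ℝ}
    (hβ : 0 < β) :
    discrepancy (fun i => u i - γ • ξ i) ≤
      (1 + β) * discrepancy u + (1 + β⁻¹) * γ ^ 2 * avg (fun i => ‖ξ i‖ ^ 2) := by
  have h1 : ∀ i, ‖u i - γ • ξ i - mean (fun i => u i - γ • ξ i)‖ ^ 2 ≤
      (1 + β) * ‖u i - mean u‖ ^ 2 + (1 + β⁻¹) * γ ^ 2 * ‖ξ i - mean ξ‖ ^ 2 := fun i => by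
    rw [mean_sub, mean_smul,
      show u i - γ • ξ i - (mean u - γ • mean ξ) = (u i - mean u) - γ • (ξ i - mean ξ) by module]
    have h2 := norm_sub_le (u i - mean u) (γ • (ξ i - mean ξ))
    have h3 := pow_le_pow_left₀ (norm_nonneg _) h2 2
    have h4 : ‖γ • (ξ i - mean ξ)‖ ^ 2 = γ ^ 2 * ‖ξ i - mean ξ‖ ^ 2 := by
      rw [norm_smul, mul_pow, Real.norm_eq_abs, sq_abs]
    rw [mul_assoc, ← h4]
    set a := ‖u i - mean u‖
    set b := ‖γ • (ξ i - mean ξ)‖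
    have h5 : 2 * a * b ≤ β * a ^ 2 + β⁻¹ * b ^ 2 := by
      have : 0 ≤ β⁻¹ * (β * a - b) ^ 2 := by positivity
      have e : β⁻¹ * (β * a - b) ^ 2 = β * a ^ 2 - 2 * a * b + β⁻¹ * b ^ 2 := by
        field_simp
        ring
      linarith
    linarith
  refine (avg_mono h1).trans ?_
  rw [avg_add, avg_mul_left, avg_mul_left]
  have := discrepancy_le hn ξ
  have h6 : 0 ≤ (1 + β⁻¹) * γ ^ 2 := by positivity
  exact add_le_add_right (mul_le_mul_of_nonneg_left this h6) _

section Sampling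

variable {Ω : Type*} [MeasurableSpace Ω] {P : Measure Ω} [IsProbabilityMeasure P] {d n m : ℕ}
  {j : Fin n → Ω → Fin m}

lemma integral_sampled (hj : ∀ i, Measurable (j i))
    (hu : ∀ i a, P.real {ω | j i ω = a} = 1 / (m : ℝ)) (G : Fin n → Fin m → Vec d) (i : Fin n) :
    ∫ ω, G i (j i ω) ∂P = mean (G i) :=
  integral_comp_of_uniform (hj i) (hu i) (G i)

lemma integral_norm_sampled_sub_sq (hj : ∀ i, Measurable (j i))
    (hu : ∀ i a, P.real {ω | j i ω = a} = 1 / (m : ℝ)) (G : Fin n → Fin m → Vec d) (i : Fin n) :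
    ∫ ω, ‖G i (j i ω) - mean (G i)‖ ^ 2 ∂P = discrepancy (G i) :=
  integral_comp_of_uniform (hj i) (hu i) fun a => ‖G i a - mean (G i)‖ ^ 2

lemma integral_norm_sampled_sq (hm : 0 < m) (hj : ∀ i, Measurable (j i))
    (hu : ∀ i a, P.real {ω | j i ω = a} = 1 / (m : ℝ)) (G : Fin n → Fin m → Vec d) (i : Fin n) :
    ∫ ω, ‖G i (j i ω)‖ ^ 2 ∂P = ‖mean (G i)‖ ^ 2 + discrepancy (G i) := by
  have h1 := avg_norm_sub_sq hm (G i) 0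
  simp only [sub_zero] at h1
  rw [← h1]
  exact integral_comp_of_uniform (hj i) (hu i) fun a => ‖G i a‖ ^ 2

lemma integral_mean_sampled (hj : ∀ i, Measurable (j i))
    (hu : ∀ i a, P.real {ω | j i ω = a} = 1 / (m : ℝ)) (G : Fin n → Fin m → Vec d) :
    ∫ ω, mean (fun i => G i (j i ω)) ∂P = mean fun i => mean (G i) := by
  unfold mean
  rw [integral_smul, integral_finsetSum _ fun i _ => integrable_comp_of_finite (hj i) (G i)]
  simp only [integral_sampled hj hu G]
  rfl

/-- With node `i` frozen, the inner integral over the index of node `l` is already zero. -/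
lemma integral_inner_sampled_of_ne (hj : ∀ i, Measurable (j i))
    (hu : ∀ i a, P.real {ω | j i ω = a} = 1 / (m : ℝ)) (hind : iIndepFun j P)
    (v : Fin n → Fin m → Vec d) (hv : ∀ i, mean (v i) = 0) {i l : Fin n} (hil : i ≠ l) :
    ∫ ω, ⟪v i (j i ω), v l (j l ω)⟫ ∂P = 0 := by
  rw [IndepFun.integral_comp_eq (hj i) (hj l) (hind.indepFun hil)
    (fun a b => ⟪v i a, v l b⟫)]
  simp only [integral_inner (integrable_comp_of_finite (hj l) (v l)),
    integral_sampled hj hu v, hv, inner_zero_right, integral_zero]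

/-- The second moment of an average of independent samples. -/
lemma integral_norm_mean_sampled_sq (hn : 0 < n) (hm : 0 < m) (hj : ∀ i, Measurable (j i))
    (hu : ∀ i a, P.real {ω | j i ω = a} = 1 / (m : ℝ)) (hind : iIndepFun j P)
    (G : Fin n → Fin m → Vec d) :
    ∫ ω, ‖mean fun i => G i (j i ω)‖ ^ 2 ∂P =
      ‖mean fun i => mean (G i)‖ ^ 2 + 1 / (n : ℝ) * avg fun i => discrepancy (G i) := by
  have hjm : Measurable fun ω i => j i ω := measurable_pi_lambda _ hj
  set b := mean fun i => mean (G i) with hb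
  let v : Fin n → Fin m → Vec d := fun i a => G i a - mean (G i)
  have hv : ∀ i, mean (v i) = 0 := fun i => by
    simp only [v, mean_sub, mean_const hm, sub_self]
  -- Split into mean and centred noise, with the noise square expanded over pairs of nodes: only the
  -- diagonal survives integration, which produces the factor 1/n.
  have h1 : ∀ ω, ‖mean fun i => G i (j i ω)‖ ^ 2 =
      ‖b‖ ^ 2 + 2 * ⟪b, mean fun i => v i (j i ω)⟫
        + (1 / (n : ℝ)) ^ 2 * ∑ i, ∑ l, ⟪v i (j i ω), v l (j l ω)⟫ := fun ω => by
    have h2 : (mean fun i => G i (j i ω)) = b + mean fun i => v i (j i ω) := by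
      simp only [v, mean_sub, hb, add_sub_cancel]
    have h3 : ‖mean fun i => v i (j i ω)‖ ^ 2 =
        (1 / (n : ℝ)) ^ 2 * ∑ i, ∑ l, ⟪v i (j i ω), v l (j l ω)⟫ := by
      rw [← real_inner_self_eq_norm_sq, mean, real_inner_smul_left, real_inner_smul_right,
        sum_inner]
      simp only [inner_sum]
      ring
    rw [h2, norm_add_sq_real, h3]
  have h4 : ∀ i, ∫ ω, ∑ l, ⟪v i (j i ω), v l (j l ω)⟫ ∂P = discrepancy (G i) := fun i => by
    rw [integral_finsetSum _ fun l _ =>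
        integrable_comp_of_finite hjm fun a => ⟪v i (a i), v l (a l)⟫,
      Finset.sum_eq_single i (fun l _ hl => integral_inner_sampled_of_ne hj hu hind v hv hl.symm)
      (by simp), ← integral_norm_sampled_sub_sq hj hu G i]
    simp only [real_inner_self_eq_norm_sq, v]
  simp only [h1]
  rw [integral_add
      (integrable_comp_of_finite hjm fun a => ‖b‖ ^ 2 + 2 * ⟪b, mean fun i => v i (a i)⟫)
      (integrable_comp_of_finite hjm fun a =>
        (1 / (n : ℝ)) ^ 2 * ∑ i, ∑ l, ⟪v i (a i), v l (a l)⟫),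
    integral_add (integrable_const _)
      (integrable_comp_of_finite hjm fun a => 2 * ⟪b, mean fun i => v i (a i)⟫),
    integral_const_mul, integral_const_mul,
    integral_inner (integrable_comp_of_finite hjm fun a => mean fun i => v i (a i)),
    integral_mean_sampled hj hu v,
    integral_finsetSum _ fun i _ =>
      integrable_comp_of_finite hjm fun a => ∑ l, ⟪v i (a i), v l (a l)⟫]
  simp only [h4, hv, mean_const hn, inner_zero_right, avg]
  simp
  ring

/-- The expected squared distance to a point after a step along the mean of the samples. -/
lemma integral_norm_sub_smul_mean_sampled_sq (hj : ∀ i, Measurable (j i))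
    (hu : ∀ i a, P.real {ω | j i ω = a} = 1 / (m : ℝ))
    (G : Fin n → Fin m → Vec d) (z : Vec d) (γ : ℝ) :
    ∫ ω, ‖z - γ • mean fun i => G i (j i ω)‖ ^ 2 ∂P =
      ‖z‖ ^ 2 - 2 * γ * ⟪z, mean fun i => mean (G i)⟫
        + γ ^ 2 * ∫ ω, ‖mean fun i => G i (j i ω)‖ ^ 2 ∂P := by
  have hjm : Measurable fun ω i => j i ω := measurable_pi_lambda _ hj
  have h1 : ∀ ω, ‖z - γ • mean fun i => G i (j i ω)‖ ^ 2 =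
      ‖z‖ ^ 2 - 2 * γ * ⟪z, mean fun i => G i (j i ω)⟫
        + γ ^ 2 * ‖mean fun i => G i (j i ω)‖ ^ 2 := fun ω => by
    rw [norm_sub_sq_real, real_inner_smul_right, norm_smul, mul_pow, Real.norm_eq_abs, sq_abs]
    ring
  simp only [h1]
  rw [integral_add
      (integrable_comp_of_finite hjm fun a =>
        ‖z‖ ^ 2 - 2 * γ * ⟪z, mean fun i => G i (a i)⟫)
      (integrable_comp_of_finite hjm fun a => γ ^ 2 * ‖mean fun i => G i (a i)‖ ^ 2),
    integral_sub (integrable_const _)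
      (integrable_comp_of_finite hjm fun a => 2 * γ * ⟪z, mean fun i => G i (a i)⟫),
    integral_const_mul, integral_const_mul,
    integral_inner (integrable_comp_of_finite hjm fun a => mean fun i => G i (a i)),
    integral_mean_sampled hj hu G]
  simp

/-- The expected discrepancy after a local step along the samples. -/
lemma integral_discrepancy_sub_smul_sampled_le (hn : 0 < n) (hm : 0 < m)
    (hj : ∀ i, Measurable (j i)) (hu : ∀ i a, P.real {ω | j i ω = a} = 1 / (m : ℝ))
    (G : Fin n → Fin m → Vec d) (x : Fin n → Vec d) (γ : ℝ) {β : ℝ} (hβ : 0 < β) :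
    ∫ ω, discrepancy (fun i => x i - γ • G i (j i ω)) ∂P ≤
      (1 + β) * discrepancy x + (1 + β⁻¹) * γ ^ 2 * avg (fun i => ‖mean (G i)‖ ^ 2)
        + γ ^ 2 * avg fun i => discrepancy (G i) := by
  have hjm : Measurable fun ω i => j i ω := measurable_pi_lambda _ hj
  let v : Fin n → Fin m → Vec d := fun i a => G i a - mean (G i)
  have hv : ∀ i, mean (v i) = 0 := fun i => by
    simp only [v, mean_sub, mean_const hm, sub_self]
  -- The deterministic step is separated from the noise before Young's inequality is applied. The
  -- noise is orthogonal to it in expectation, so its variance does not receive the factor 1 + β⁻¹.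
  let u : Fin n → Vec d := fun i => x i - γ • mean (G i)
  have h1 : ∀ ω, discrepancy (fun i => x i - γ • G i (j i ω)) ≤
      discrepancy u - 2 * γ * avg (fun i => ⟪u i - mean u, v i (j i ω)⟫)
        + γ ^ 2 * avg fun i => ‖v i (j i ω)‖ ^ 2 := fun ω => by
    have h2 : (fun i => x i - γ • G i (j i ω)) = fun i => u i - γ • v i (j i ω) := by
      funext i
      simp only [u, v]
      module
    rw [h2, discrepancy_sub_smul hn]
    have := discrepancy_le hn fun i => v i (j i ω)
    gcongr
  have h3 : ∫ ω, avg (fun i => ⟪u i - mean u, v i (j i ω)⟫) ∂P = 0 := by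
    unfold avg
    rw [integral_const_mul, integral_finsetSum _ fun i _ =>
      integrable_comp_of_finite hjm fun a => ⟪u i - mean u, v i (a i)⟫]
    simp only [integral_inner (integrable_comp_of_finite (hj _) (v _)), integral_sampled hj hu v,
      hv, inner_zero_right, Finset.sum_const_zero, mul_zero]
  have h4 : ∫ ω, avg (fun i => ‖v i (j i ω)‖ ^ 2) ∂P = avg fun i => discrepancy (G i) := by
    unfold avg
    rw [integral_const_mul, integral_finsetSum _ fun i _ =>
      integrable_comp_of_finite hjm fun a => ‖v i (a i)‖ ^ 2]
    simp only [v, integral_norm_sampled_sub_sq hj hu G]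
  have h5 := integral_mono
    (integrable_comp_of_finite (P := P) hjm fun a => discrepancy (fun i => x i - γ • G i (a i)))
    (integrable_comp_of_finite (P := P) hjm fun a =>
      discrepancy u - 2 * γ * avg (fun i => ⟪u i - mean u, v i (a i)⟫)
        + γ ^ 2 * avg fun i => ‖v i (a i)‖ ^ 2) h1
  rw [integral_add
      (integrable_comp_of_finite hjm fun a =>
        discrepancy u - 2 * γ * avg (fun i => ⟪u i - mean u, v i (a i)⟫))
      (integrable_comp_of_finite hjm fun a => γ ^ 2 * avg fun i => ‖v i (a i)‖ ^ 2),
    integral_sub (integrable_const _)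
      (integrable_comp_of_finite hjm fun a =>
        2 * γ * avg (fun i => ⟪u i - mean u, v i (a i)⟫)),
    integral_const_mul, integral_const_mul, h3, h4] at h5
  have h6 := discrepancy_sub_smul_le hn x (fun i => mean (G i)) γ hβ
  simp only [integral_const, probReal_univ, one_smul, mul_zero, sub_zero] at h5
  exact h5.trans (by gcongr)

end Sampling

/-! ### The loopless SVRG directions -/

section Direction

variable {d n m : ℕ} {F : Fin n → Fin m → Vec d → ℝ} {L M : ℝ} {xs : Vec d}

lemma refVariance_eq (w : Fin n → Vec d) :
    refVariance F xs w = 4 * avg fun i => avg fun j => ‖∇ (F i j) (w i) - ∇ (F i j) xs‖ ^ 2 := by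
  simp only [refVariance, avg, ← Finset.mul_sum]
  ring

lemma refVariance_nonneg (w : Fin n → Vec d) : 0 ≤ refVariance F xs w := by
  rw [refVariance_eq]
  exact mul_nonneg (by norm_num) (avg_nonneg fun i => avg_nonneg fun j => sq_nonneg _)

/-- The two reference terms cancel on averaging over the index, so the mean does not depend on `w`.
That is why conditioning on the local iterates alone suffices later. -/
lemma mean_direction (hm : 0 < m) (hF : ∀ i j, Differentiable ℝ (F i j)) (i : Fin n)
    (x w : Vec d) : (mean fun j => direction F i j x w) = ∇ (localObj F i) x := by
  simp only [direction, mean_add, mean_sub, mean_const hm, gradient_localObj hF]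
  simp only [mean]
  abel

lemma avg_norm_gradient_sub_sq_le (hM : 0 ≤ M) (hc : ∀ i j, ConvexOn ℝ Set.univ (F i j))
    (hs : ∀ i j, IsSmooth M (F i j)) (i : Fin n) (x y : Vec d) :
    (avg fun j => ‖∇ (F i j) x - ∇ (F i j) y‖ ^ 2) ≤ 2 * M * bregman (localObj F i) x y := by
  refine (avg_mono fun j => (hs i j).norm_gradient_sub_sq_le hM (hc i j) x y).trans_eq ?_
  rw [avg_mul_left, ← sum_bregman_localObj fun i j => (hs i j).1]
  rfl

/-- A variance is at most the second moment about any point. Centring at the full gradient at `w`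
leaves a difference of component gradients, which is split through `xs`. -/
lemma discrepancy_direction_le (hm : 0 < m) (hM : 0 ≤ M)
    (hc : ∀ i j, ConvexOn ℝ Set.univ (F i j)) (hs : ∀ i j, IsSmooth M (F i j))
    (i : Fin n) (x w : Vec d) :
    discrepancy (fun j => direction F i j x w) ≤ 4 * M * bregman (localObj F i) x xs
      + 2 * avg fun j => ‖∇ (F i j) w - ∇ (F i j) xs‖ ^ 2 := by
  have h1 := avg_norm_sub_sq hm (fun j => direction F i j x w) (∇ (localObj F i) w)
  have h2 : ∀ j, ‖direction F i j x w - ∇ (localObj F i) w‖ ^ 2 ≤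
      2 * ‖∇ (F i j) x - ∇ (F i j) xs‖ ^ 2 + 2 * ‖∇ (F i j) w - ∇ (F i j) xs‖ ^ 2 := fun j => by
    rw [direction, add_sub_cancel_right,
      ← sub_sub_sub_cancel_right (∇ (F i j) x) (∇ (F i j) w) (∇ (F i j) xs)]
    have h3 := norm_sub_le (∇ (F i j) x - ∇ (F i j) xs) (∇ (F i j) w - ∇ (F i j) xs)
    have h4 := pow_le_pow_left₀ (norm_nonneg _) h3 2
    linarith [sq_nonneg (‖∇ (F i j) x - ∇ (F i j) xs‖ - ‖∇ (F i j) w - ∇ (F i j) xs‖)]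
  have h5 := avg_mono h2
  rw [avg_add, avg_mul_left, avg_mul_left] at h5
  have h6 := avg_norm_gradient_sub_sq_le hM hc hs i x xs
  linarith [sq_nonneg ‖(mean fun j => direction F i j x w) - ∇ (localObj F i) w‖]

variable (hn : 0 < n) (hL : 0 ≤ L) (hM : 0 ≤ M) (hf : ∀ i, IsSmooth L (localObj F i))
  (hfc : ∀ i, ConvexOn ℝ Set.univ (localObj F i))
  (hc : ∀ i j, ConvexOn ℝ Set.univ (F i j)) (hs : ∀ i j, IsSmooth M (F i j))
  (hxs : IsMinOn (globalObj (localObj F)) Set.univ xs)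
include hn hL hM hf hfc hc hs hxs

lemma avg_discrepancy_direction_le (hm : 0 < m) (x w : Fin n → Vec d) :
    avg (fun i => discrepancy fun j => direction F i j (x i) (w i)) ≤
      8 * M * (globalObj (localObj F) (mean x) - globalObj (localObj F) xs)
        + 1 / 2 * refVariance F xs w + 4 * L * M * discrepancy x := by
  refine (avg_mono fun i => discrepancy_direction_le (xs := xs) hm hM hc hs i (x i) (w i)).trans ?_
  have h1 := avg_bregman_le hn hL hf hfc hxs x
  rw [avg_add, avg_mul_left, avg_mul_left, refVariance_eq]
  nlinarith

/-- Applied to the local iterates, this bounds the contribution of refreshed reference points to the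
next σ². -/
lemma refVariance_le (x : Fin n → Vec d) :
    refVariance F xs x ≤
      16 * M * (globalObj (localObj F) (mean x) - globalObj (localObj F) xs)
        + 8 * L * M * discrepancy x := by
  have h1 := avg_mono fun i => avg_norm_gradient_sub_sq_le hM hc hs i (x i) xs
  have h2 := avg_bregman_le hn hL hf hfc hxs x
  rw [avg_mul_left] at h1
  rw [refVariance_eq]
  nlinarith

end Direction

/-- Each summand involves the coin of one node only, so linearity suffices and the joint law of the
coins plays no role. -/
lemma integral_refVariance_coin {Ω : Type*} [MeasurableSpace Ω] {P : Measure Ω}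
    [IsProbabilityMeasure P] {d n m : ℕ} {b : Fin n → Ω → Bool} {q : ℝ}
    (hb : ∀ i, Measurable (b i)) (hq : ∀ i, P.real {ω | b i ω = true} = q)
    (F : Fin n → Fin m → Vec d → ℝ) (xs : Vec d) (x w : Fin n → Vec d) :
    ∫ ω, refVariance F xs (fun i => if b i ω = true then x i else w i) ∂P =
      q * refVariance F xs x + (1 - q) * refVariance F xs w := by
  have h1 : ∀ ω i j, ‖∇ (F i j) (if b i ω = true then x i else w i) - ∇ (F i j) xs‖ ^ 2 =
      if b i ω = true then ‖∇ (F i j) (x i) - ∇ (F i j) xs‖ ^ 2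
        else ‖∇ (F i j) (w i) - ∇ (F i j) xs‖ ^ 2 := fun ω i j => by
    split_ifs <;> rfl
  have h2 : ∀ i j, Integrable (fun ω => if b i ω = true
      then ‖∇ (F i j) (x i) - ∇ (F i j) xs‖ ^ 2
      else ‖∇ (F i j) (w i) - ∇ (F i j) xs‖ ^ 2) P := fun i j =>
    integrable_comp_of_finite (hb i) fun c : Bool => if c = true
      then ‖∇ (F i j) (x i) - ∇ (F i j) xs‖ ^ 2 else ‖∇ (F i j) (w i) - ∇ (F i j) xs‖ ^ 2
  unfold refVariance
  simp only [h1]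
  rw [integral_const_mul, integral_finsetSum _ fun i _ => integrable_finsetSum _ fun j _ => h2 i j]
  simp only [integral_finsetSum _ fun j _ => h2 _ j, integral_ite_coin (hb _) (hq _),
    Finset.sum_add_distrib, ← Finset.mul_sum]
  ring

/-! ### The state as a function of the past -/

section Past

variable {Ω : Type*} {d n m : ℕ} (F : Fin n → Fin m → Vec d → ℝ) (γ : ℝ) (τ : ℕ) (x0 : Vec d)
  (w0 : Fin n → Vec d) (J : ℕ → Fin n → Ω → Fin m) (B : ℕ → Fin n → Ω → Bool)

/-- The random choices made in iteration `k`. -/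
def choice (k : ℕ) (ω : Ω) : (Fin n → Fin m) × (Fin n → Bool) :=
  (fun i => J k i ω, fun i => B k i ω)

/-- The random choices made before iteration `k`. -/
def pastChoices (k : ℕ) (ω : Ω) (l : Fin k) : (Fin n → Fin m) × (Fin n → Bool) :=
  choice J B l ω

/-- The domain of `S` is finite, so no regularity of the gradients is needed for measurability or
integrability of functions of the state. -/
lemma exists_state_eq (k : ℕ) :
    ∃ S : (Fin k → (Fin n → Fin m) × (Fin n → Bool)) → (Fin n → Vec d) × (Fin n → Vec d),
      ∀ ω, state F γ τ x0 w0 (fun k i => J k i ω) (fun k i => B k i ω) k =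
        S (pastChoices J B k ω) := by
  induction k with
  | zero => exact ⟨fun _ => (fun _ => x0, w0), fun _ => rfl⟩
  | succ k ih =>
    obtain ⟨S, hS⟩ := ih
    refine ⟨fun z =>
      let x := (S fun l => z l.castSucc).1
      let w := (S fun l => z l.castSucc).2
      let y : Fin n → Vec d := fun i =>
        x i - γ • direction F i ((z (Fin.last k)).1 i) (x i) (w i)
      (fun i => if (k + 1) % τ = 0 then mean y else y i,
        fun i => if (z (Fin.last k)).2 i = true then x i else w i), fun ω => ?_⟩
    rw [state, hS]
    rfl

lemma history_eq_comap (k : ℕ) :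
    history J B k = MeasurableSpace.comap (pastChoices J B k) inferInstance := by
  change _ = MeasurableSpace.comap _ MeasurableSpace.pi
  rw [MeasurableSpace.pi, MeasurableSpace.comap_iSup]
  simp only [MeasurableSpace.comap_comp]
  rfl

lemma measurable_iterate_history (k : ℕ) :
    Measurable[history J B k] fun ω i => iterate F γ τ x0 w0 J B k i ω := by
  obtain ⟨S, hS⟩ := exists_state_eq F γ τ x0 w0 J B k
  simp only [iterate, hS]
  rw [history_eq_comap]
  exact (measurable_of_finite fun z => (S z).1).comp (comap_measurable _)

variable [MeasurableSpace Ω] {P : Measure Ω} {q : ℝ} {J B}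

lemma IsSampling.measurable_choice (h : IsSampling P q J B) (k : ℕ) :
    Measurable (choice J B k) :=
  (measurable_pi_lambda _ (h.measurable_index k)).prodMk
    (measurable_pi_lambda _ (h.measurable_coin k))

lemma IsSampling.measurable_pastChoices (h : IsSampling P q J B) (k : ℕ) :
    Measurable (pastChoices J B k) :=
  measurable_pi_lambda _ fun l => h.measurable_choice l

lemma IsSampling.indepFun_pastChoices (h : IsSampling P q J B) (k : ℕ) :
    IndepFun (pastChoices J B k) (choice J B k) P := by
  have h1 : iIndepFun (choice J B) P := h.indep_iterations
  have h2 := h1.indepFun_finset (Finset.range k) {k} (by simp) h.measurable_choice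
  have h3 : Measurable fun (z : Finset.range k → (Fin n → Fin m) × (Fin n → Bool)) (l : Fin k) =>
      z ⟨l, Finset.mem_range.2 l.2⟩ :=
    measurable_pi_lambda _ fun l => measurable_pi_apply _
  have h4 : Measurable fun z : ({k} : Finset ℕ) → (Fin n → Fin m) × (Fin n → Bool) =>
      z ⟨k, Finset.mem_singleton_self k⟩ := measurable_pi_apply _
  exact h2.comp h3 h4

/-- Fubini for the randomness before iteration `k` and that of iteration `k`. -/
lemma IsSampling.integral_eq [IsProbabilityMeasure P] (h : IsSampling P q J B)
    {E : Type*} [NormedAddCommGroup E] [NormedSpace ℝ E] (k : ℕ)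
    (φ : (Fin n → Vec d) → (Fin n → Vec d) → (Fin n → Fin m) → (Fin n → Bool) → E) :
    ∫ ω, φ (fun i => iterate F γ τ x0 w0 J B k i ω) (fun i => refPoint F γ τ x0 w0 J B k i ω)
        (fun i => J k i ω) (fun i => B k i ω) ∂P =
      ∫ ω, ∫ ω', φ (fun i => iterate F γ τ x0 w0 J B k i ω)
        (fun i => refPoint F γ τ x0 w0 J B k i ω)
        (fun i => J k i ω') (fun i => B k i ω') ∂P ∂P := by
  obtain ⟨S, hS⟩ := exists_state_eq F γ τ x0 w0 J B k
  simp only [iterate, refPoint, hS]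
  exact IndepFun.integral_comp_eq (h.measurable_pastChoices k) (h.measurable_choice k)
    (h.indepFun_pastChoices k) fun z c => φ (S z).1 (S z).2 c.1 c.2

lemma IsSampling.integrable [IsFiniteMeasure P] (h : IsSampling P q J B)
    {E : Type*} [NormedAddCommGroup E] (k : ℕ)
    (φ : (Fin n → Vec d) → (Fin n → Vec d) → (Fin n → Fin m) → (Fin n → Bool) → E) :
    Integrable (fun ω => φ (fun i => iterate F γ τ x0 w0 J B k i ω)
      (fun i => refPoint F γ τ x0 w0 J B k i ω) (fun i => J k i ω) (fun i => B k i ω)) P := by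
  obtain ⟨S, hS⟩ := exists_state_eq F γ τ x0 w0 J B k
  simp only [iterate, refPoint, hS]
  exact integrable_comp_of_finite ((h.measurable_pastChoices k).prodMk (h.measurable_choice k))
    fun p : (Fin k → (Fin n → Fin m) × (Fin n → Bool)) × ((Fin n → Fin m) × (Fin n → Bool)) =>
      φ (S p.1).1 (S p.1).2 p.2.1 p.2.2

lemma IsSampling.history_le (h : IsSampling P q J B) (k : ℕ) :
    history J B k ≤ ‹MeasurableSpace Ω› := by
  rw [history_eq_comap]
  exact (h.measurable_pastChoices k).comap_le

/-- The conditional expectation, given the past, of a function of the state and of the choices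
of the current iteration. -/
lemma IsSampling.condExp_history [IsProbabilityMeasure P] (h : IsSampling P q J B)
    {E : Type*} [NormedAddCommGroup E] [NormedSpace ℝ E] [CompleteSpace E] (k : ℕ)
    (φ : (Fin n → Vec d) → (Fin n → Vec d) → (Fin n → Fin m) → E)
    (ψ : (Fin n → Vec d) → E)
    (hφ : ∀ x w, ∫ ω, φ x w (fun i => J k i ω) ∂P = ψ x) :
    P[fun ω => φ (fun i => iterate F γ τ x0 w0 J B k i ω)
        (fun i => refPoint F γ τ x0 w0 J B k i ω) (fun i => J k i ω) | history J B k] =ᵐ[P]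
      fun ω => ψ fun i => iterate F γ τ x0 w0 J B k i ω := by
  have hint := h.integrable F γ τ x0 w0 k fun x w j _ => φ x w j
  have hint' := h.integrable F γ τ x0 w0 k fun x _ _ _ => ψ x
  symm
  refine ae_eq_condExp_of_forall_setIntegral_eq (h.history_le k) hint
    (fun s _ _ => hint'.integrableOn) (fun s hs _ => ?_) ?_
  · rw [history_eq_comap] at hs
    obtain ⟨A, -, rfl⟩ := hs
    -- An event of the history is a condition on the past choices, so its indicator belongs to the
    -- frozen variable in Fubini and the hypothesis applies under the inner integral.
    have hA : MeasurableSet (pastChoices J B k ⁻¹' A) :=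
      h.measurable_pastChoices k A.toFinite.measurableSet
    rw [← integral_indicator hA, ← integral_indicator hA]
    obtain ⟨S, hS⟩ := exists_state_eq F γ τ x0 w0 J B k
    simp only [iterate, refPoint, hS]
    have h1 := IndepFun.integral_comp_eq (h.measurable_pastChoices k) (h.measurable_choice k)
      (h.indepFun_pastChoices k) fun z c => A.indicator (fun z => φ (S z).1 (S z).2 c.1) z
    have h2 : ∀ z, ∫ ω', A.indicator (fun z => φ (S z).1 (S z).2 (choice J B k ω').1) z ∂P =
        A.indicator (fun z => ψ (S z).1) z := fun z => by
      by_cases hz : z ∈ A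
      · simp only [Set.indicator_of_mem hz]
        exact hφ _ _
      · simp [Set.indicator_of_notMem hz]
    simp only [h2] at h1
    exact h1.symm
  · obtain ⟨S, hS⟩ := exists_state_eq F γ τ x0 w0 J B k
    simp only [iterate, hS]
    rw [history_eq_comap]
    exact ((StronglyMeasurable.of_discrete (f := fun z => ψ (S z).1)).comp_measurable
      (comap_measurable _)).aestronglyMeasurable

end Past

/-! ### Expectations along the iterations -/

/-- The local iterates of all the nodes. -/
noncomputable abbrev iterates {Ω : Type*} {d n m : ℕ} (F : Fin n → Fin m → Vec d → ℝ) (γ : ℝ) (τ : ℕ)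
    (x0 : Vec d) (w0 : Fin n → Vec d) (J : ℕ → Fin n → Ω → Fin m) (B : ℕ → Fin n → Ω → Bool)
    (k : ℕ) (ω : Ω) : Fin n → Vec d :=
  fun i => iterate F γ τ x0 w0 J B k i ω

/-- The reference points of all the nodes. -/
noncomputable abbrev refPoints {Ω : Type*} {d n m : ℕ} (F : Fin n → Fin m → Vec d → ℝ) (γ : ℝ) (τ : ℕ)
    (x0 : Vec d) (w0 : Fin n → Vec d) (J : ℕ → Fin n → Ω → Fin m) (B : ℕ → Fin n → Ω → Bool)
    (k : ℕ) (ω : Ω) : Fin n → Vec d :=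
  fun i => refPoint F γ τ x0 w0 J B k i ω

/-- The standing assumptions on the objectives and on the sampling. -/
structure Setting {Ω : Type*} [MeasurableSpace Ω] (P : Measure Ω) {d n m : ℕ}
    (F : Fin n → Fin m → Vec d → ℝ) (L M μ : ℝ) (xs : Vec d) (q : ℝ)
    (J : ℕ → Fin n → Ω → Fin m) (B : ℕ → Fin n → Ω → Bool) : Prop where
  n_pos : 0 < n
  m_pos : 0 < m
  L_nonneg : 0 ≤ L
  M_nonneg : 0 ≤ M
  μ_nonneg : 0 ≤ μ
  strongConvex : ∀ i, StrongConvexOn Set.univ μ (localObj F i)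
  smooth : ∀ i, IsSmooth L (localObj F i)
  convex_component : ∀ i j, ConvexOn ℝ Set.univ (F i j)
  smooth_component : ∀ i j, IsSmooth M (F i j)
  isMinOn : IsMinOn (globalObj (localObj F)) Set.univ xs
  q_pos : 0 < q
  q_lt_one : q < 1
  sampling : IsSampling P q J B

section Expectations

variable {Ω : Type*} [MeasurableSpace Ω] {P : Measure Ω} [IsProbabilityMeasure P] {d n m : ℕ}
  {F : Fin n → Fin m → Vec d → ℝ} {L M μ : ℝ} {xs : Vec d} {q : ℝ}
  {J : ℕ → Fin n → Ω → Fin m} {B : ℕ → Fin n → Ω → Bool}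
  {γ : ℝ} {τ : ℕ} {x0 : Vec d} {w0 : Fin n → Vec d}

local notation "X" => iterates F γ τ x0 w0 J B
local notation "W" => refPoints F γ τ x0 w0 J B

omit [IsProbabilityMeasure P] in
lemma Setting.convex (h : Setting P F L M μ xs q J B) (i : Fin n) :
    ConvexOn ℝ Set.univ (localObj F i) :=
  strongConvexOn_zero.1 ((h.strongConvex i).mono h.μ_nonneg)

lemma Setting.integrable (h : Setting P F L M μ xs q J B) {E : Type*} [NormedAddCommGroup E]
    (k : ℕ) (φ : (Fin n → Vec d) → (Fin n → Vec d) → E) :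
    Integrable (fun ω => φ (X k ω) (W k ω)) P :=
  h.sampling.integrable F γ τ x0 w0 k fun x w _ _ => φ x w

lemma Setting.integral_eq (h : Setting P F L M μ xs q J B) (k : ℕ)
    {φ : (Fin n → Vec d) → (Fin n → Vec d) → (Fin n → Fin m) → (Fin n → Bool) → ℝ}
    {ψ : (Fin n → Vec d) → (Fin n → Vec d) → ℝ}
    (hφ : ∀ x w, ∫ ω, φ x w (fun i => J k i ω) (fun i => B k i ω) ∂P = ψ x w) :
    ∫ ω, φ (X k ω) (W k ω) (fun i => J k i ω) (fun i => B k i ω) ∂P =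
      ∫ ω, ψ (X k ω) (W k ω) ∂P :=
  (h.sampling.integral_eq F γ τ x0 w0 k φ).trans (by simp only [hφ])

lemma Setting.integral_le (h : Setting P F L M μ xs q J B) (k : ℕ)
    {φ : (Fin n → Vec d) → (Fin n → Vec d) → (Fin n → Fin m) → (Fin n → Bool) → ℝ}
    {ψ : (Fin n → Vec d) → (Fin n → Vec d) → ℝ}
    (hφ : ∀ x w, ∫ ω, φ x w (fun i => J k i ω) (fun i => B k i ω) ∂P ≤ ψ x w) :
    ∫ ω, φ (X k ω) (W k ω) (fun i => J k i ω) (fun i => B k i ω) ∂P ≤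
      ∫ ω, ψ (X k ω) (W k ω) ∂P := by
  rw [h.integral_eq k fun _ _ => rfl]
  exact integral_mono (h.integrable k fun x w =>
      ∫ ω, φ x w (fun i => J k i ω) (fun i => B k i ω) ∂P)
    (h.integrable k ψ) fun ω => hφ _ _

/-- A pointwise bound by suboptimality, reference variance and discrepancy, in expectation. -/
lemma Setting.integral_le_of_forall_le (h : Setting P F L M μ xs q J B) (k : ℕ)
    {φ : (Fin n → Vec d) → (Fin n → Vec d) → ℝ} {c₁ c₂ c₃ c₄ : ℝ}
    (hφ : ∀ x w, φ x w ≤ c₁ * (globalObj (localObj F) (mean x) - globalObj (localObj F) xs)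
      + c₂ * refVariance F xs w + c₃ * discrepancy x + c₄) :
    ∫ ω, φ (X k ω) (W k ω) ∂P ≤
      c₁ * ∫ ω, (globalObj (localObj F) (mean (X k ω)) - globalObj (localObj F) xs) ∂P
        + c₂ * ∫ ω, refVariance F xs (W k ω) ∂P + c₃ * ∫ ω, discrepancy (X k ω) ∂P + c₄ := by
  have i1 := h.integrable (γ := γ) (τ := τ) (x0 := x0) (w0 := w0) k fun x _ =>
    c₁ * (globalObj (localObj F) (mean x) - globalObj (localObj F) xs)
  have i2 := h.integrable (γ := γ) (τ := τ) (x0 := x0) (w0 := w0) k fun _ w =>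
    c₂ * refVariance F xs w
  have i3 := h.integrable (γ := γ) (τ := τ) (x0 := x0) (w0 := w0) k fun x _ =>
    c₃ * discrepancy x
  refine (integral_mono (h.integrable k φ) (((i1.add i2).add i3).add (integrable_const c₄))
    fun ω => hφ (X k ω) (W k ω)).trans_eq ?_
  rw [integral_add' ((i1.add i2).add i3) (integrable_const c₄), integral_add' (i1.add i2) i3,
    integral_add' i1 i2, integral_const_mul, integral_const_mul, integral_const_mul]
  simp

omit [MeasurableSpace Ω] in
lemma iterates_zero (ω : Ω) : X 0 ω = fun _ => x0 := rfl

omit [MeasurableSpace Ω] in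
lemma iterates_succ_of_mod_eq_zero {k : ℕ} (hk : (k + 1) % τ = 0) (ω : Ω) :
    X (k + 1) ω = fun _ =>
      mean fun l => X k ω l - γ • direction F l (J k l ω) (X k ω l) (W k ω l) :=
  funext fun _ => if_pos hk

omit [MeasurableSpace Ω] in
lemma iterates_succ_of_mod_ne_zero {k : ℕ} (hk : (k + 1) % τ ≠ 0) (ω : Ω) :
    X (k + 1) ω = fun i =>
      X k ω i - γ • direction F i (J k i ω) (X k ω i) (W k ω i) :=
  funext fun _ => if_neg hk

omit [MeasurableSpace Ω] in
lemma mean_iterates_succ (hn : 0 < n) (k : ℕ) (ω : Ω) :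
    mean (X (k + 1) ω) = mean (X k ω)
      - γ • mean fun i => direction F i (J k i ω) (X k ω i) (W k ω i) := by
  rw [← mean_smul, ← mean_sub]
  by_cases hk : (k + 1) % τ = 0
  · rw [iterates_succ_of_mod_eq_zero hk, mean_const hn]
  · rw [iterates_succ_of_mod_ne_zero hk]

omit [IsProbabilityMeasure P] in
lemma Setting.gap_nonneg (h : Setting P F L M μ xs q J B) (x : Vec d) :
    0 ≤ globalObj (localObj F) x - globalObj (localObj F) xs :=
  sub_nonneg.2 (h.isMinOn (Set.mem_univ x))

lemma Setting.integral_sigma_succ_le (h : Setting P F L M μ xs q J B) (k : ℕ) :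
    ∫ ω, refVariance F xs (W (k + 1) ω) ∂P ≤ (1 - q) * ∫ ω, refVariance F xs (W k ω) ∂P
      + 16 * q * M *
        ∫ ω, (globalObj (localObj F) (mean (X k ω)) - globalObj (localObj F) xs) ∂P
      + 8 * q * L * M * ∫ ω, discrepancy (X k ω) ∂P := by
  have h1 := h.integral_eq (γ := γ) (τ := τ) (x0 := x0) (w0 := w0) k
    (φ := fun x w _ b => refVariance F xs fun i => if b i = true then x i else w i)
    (ψ := fun x w => q * refVariance F xs x + (1 - q) * refVariance F xs w) fun x w =>
      integral_refVariance_coin (h.sampling.measurable_coin k) (h.sampling.coin_prob k) F xs x w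
  have h2 := h.integral_le_of_forall_le (γ := γ) (τ := τ) (x0 := x0) (w0 := w0) k
    (φ := fun x w => q * refVariance F xs x + (1 - q) * refVariance F xs w)
    (c₁ := 16 * q * M) (c₂ := 1 - q) (c₃ := 8 * q * L * M) (c₄ := 0) fun x w => by
      have := mul_le_mul_of_nonneg_left (refVariance_le h.n_pos h.L_nonneg h.M_nonneg h.smooth
        h.convex h.convex_component h.smooth_component h.isMinOn x) h.q_pos.le
      linarith
  refine (h1.trans_le h2).trans_eq ?_
  ring

omit [IsProbabilityMeasure P] in
lemma Setting.mean_direction (h : Setting P F L M μ xs q J B) (i : Fin n) (x w : Vec d) :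
    (mean fun j => direction F i j x w) = ∇ (localObj F i) x :=
  LocalSVRG.mean_direction h.m_pos (fun i j => (h.smooth_component i j).1) i x w

lemma Setting.integral_norm_direction_sub_sq (h : Setting P F L M μ xs q J B) (k : ℕ)
    (i : Fin n) :
    ∫ ω, ‖direction F i (J k i ω) (X k ω i) (W k ω i) - ∇ (localObj F i) (X k ω i)‖ ^ 2 ∂P =
      ∫ ω, discrepancy (fun j => direction F i j (X k ω i) (W k ω i)) ∂P :=
  h.integral_eq k
    (φ := fun x w j _ => ‖direction F i (j i) (x i) (w i) - ∇ (localObj F i) (x i)‖ ^ 2)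
    (ψ := fun x w => discrepancy fun j => direction F i j (x i) (w i)) fun x w => by
      have := integral_norm_sampled_sub_sq (h.sampling.measurable_index k)
        (h.sampling.uniform_index k) (fun i j => direction F i j (x i) (w i)) i
      simp only [h.mean_direction] at this
      exact this

lemma Setting.avg_integral_norm_direction_sub_sq_le (h : Setting P F L M μ xs q J B) (k : ℕ) :
    avg (fun i => ∫ ω, ‖direction F i (J k i ω) (X k ω i) (W k ω i)
        - ∇ (localObj F i) (X k ω i)‖ ^ 2 ∂P) ≤
      8 * M * ∫ ω, (globalObj (localObj F) (mean (X k ω)) - globalObj (localObj F) xs) ∂P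
        + 1 / 2 * ∫ ω, refVariance F xs (W k ω) ∂P
        + 4 * L * M * ∫ ω, discrepancy (X k ω) ∂P := by
  have h2 := h.integral_le_of_forall_le (γ := γ) (τ := τ) (x0 := x0) (w0 := w0) k
    (φ := fun x w => avg fun i => discrepancy fun j => direction F i j (x i) (w i))
    (c₁ := 8 * M) (c₂ := 1 / 2) (c₃ := 4 * L * M) (c₄ := 0) fun x w => by
      rw [add_zero]
      exact avg_discrepancy_direction_le h.n_pos h.L_nonneg h.M_nonneg h.smooth
        h.convex h.convex_component h.smooth_component h.isMinOn h.m_pos x w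
  rw [add_zero] at h2
  refine Eq.trans_le ?_ h2
  simp only [h.integral_norm_direction_sub_sq, avg]
  rw [integral_const_mul, integral_finsetSum _ fun i _ =>
    h.integrable k fun x w => discrepancy fun j => direction F i j (x i) (w i)]

lemma Setting.avg_integral_norm_gradient_sq_le (h : Setting P F L M μ xs q J B) (k : ℕ) :
    avg (fun i => ∫ ω, ‖∇ (localObj F i) (X k ω i)‖ ^ 2 ∂P) ≤
      6 * L * ∫ ω, (globalObj (localObj F) (mean (X k ω)) - globalObj (localObj F) xs) ∂P
        + 3 * L ^ 2 * ∫ ω, discrepancy (X k ω) ∂P + 3 * zetaStarSq (localObj F) xs := by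
  have h2 := h.integral_le_of_forall_le (γ := γ) (τ := τ) (x0 := x0) (w0 := w0) k
    (φ := fun x _ => avg fun i => ‖∇ (localObj F i) (x i)‖ ^ 2)
    (c₁ := 6 * L) (c₂ := 0) (c₃ := 3 * L ^ 2) (c₄ := 3 * zetaStarSq (localObj F) xs)
    fun x w => by
      rw [zero_mul, add_zero]
      exact avg_norm_gradient_sq_le h.n_pos h.L_nonneg h.smooth h.convex h.isMinOn x
  rw [zero_mul, add_zero] at h2
  refine Eq.trans_le ?_ h2
  simp only [avg]
  rw [integral_const_mul, integral_finsetSum _ fun i _ =>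
    h.integrable k fun x _ => ‖∇ (localObj F i) (x i)‖ ^ 2]

lemma Setting.integral_norm_direction_sq (h : Setting P F L M μ xs q J B) (k : ℕ) (i : Fin n) :
    ∫ ω, ‖direction F i (J k i ω) (X k ω i) (W k ω i)‖ ^ 2 ∂P =
      ∫ ω, ‖∇ (localObj F i) (X k ω i)‖ ^ 2 ∂P
        + ∫ ω, ‖direction F i (J k i ω) (X k ω i) (W k ω i)
            - ∇ (localObj F i) (X k ω i)‖ ^ 2 ∂P := by
  rw [h.integral_norm_direction_sub_sq,
    ← integral_add (h.integrable k fun x _ => ‖∇ (localObj F i) (x i)‖ ^ 2)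
      (h.integrable k fun x w => discrepancy fun j => direction F i j (x i) (w i))]
  refine h.integral_eq k
    (φ := fun x w j _ => ‖direction F i (j i) (x i) (w i)‖ ^ 2)
    (ψ := fun x w => ‖∇ (localObj F i) (x i)‖ ^ 2
      + discrepancy fun j => direction F i j (x i) (w i)) fun x w => ?_
  have := integral_norm_sampled_sq h.m_pos (h.sampling.measurable_index k)
    (h.sampling.uniform_index k) (fun i j => direction F i j (x i) (w i)) i
  simp only [h.mean_direction] at this
  exact this

lemma Setting.avg_integral_norm_direction_sq_le (h : Setting P F L M μ xs q J B) (k : ℕ) :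
    avg (fun i => ∫ ω, ‖direction F i (J k i ω) (X k ω i) (W k ω i)‖ ^ 2 ∂P) ≤
      2 * (3 * L + 4 * M) *
          ∫ ω, (globalObj (localObj F) (mean (X k ω)) - globalObj (localObj F) xs) ∂P
        + 1 / 2 * ∫ ω, refVariance F xs (W k ω) ∂P
        + (3 * L ^ 2 + 4 * L * M) * ∫ ω, discrepancy (X k ω) ∂P
        + 3 * zetaStarSq (localObj F) xs := by
  have h1 := h.avg_integral_norm_direction_sub_sq_le (γ := γ) (τ := τ) (x0 := x0) (w0 := w0) k
  have h2 := h.avg_integral_norm_gradient_sq_le (γ := γ) (τ := τ) (x0 := x0) (w0 := w0) k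
  simp only [h.integral_norm_direction_sq, avg_add]
  linarith

lemma Setting.integral_norm_mean_direction_sq_le_of_state (h : Setting P F L M μ xs q J B) (k : ℕ)
    (x w : Fin n → Vec d) :
    ∫ ω, ‖mean fun i => direction F i (J k i ω) (x i) (w i)‖ ^ 2 ∂P ≤
      2 * (4 * M / n + L) * (globalObj (localObj F) (mean x) - globalObj (localObj F) xs)
        + 1 / n * refVariance F xs w + (4 * L * M / n + 2 * L ^ 2) * discrepancy x := by
  have h1 := integral_norm_mean_sampled_sq h.n_pos h.m_pos (h.sampling.measurable_index k)
    (h.sampling.uniform_index k) (h.sampling.indep_nodes k)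
    (fun i j => direction F i j (x i) (w i))
  simp only [h.mean_direction] at h1
  rw [h1]
  have h2 := norm_mean_gradient_sq_le h.n_pos h.L_nonneg h.smooth h.convex h.isMinOn x
  have hn : (0 : ℝ) ≤ 1 / n := by positivity
  have h3 := mul_le_mul_of_nonneg_left (avg_discrepancy_direction_le h.n_pos h.L_nonneg h.M_nonneg
    h.smooth h.convex h.convex_component h.smooth_component h.isMinOn h.m_pos x w) hn
  have h4 : 0 ≤ 1 / (n : ℝ) * refVariance F xs w := mul_nonneg hn (refVariance_nonneg w)
  have h5 : 0 ≤ L ^ 2 * discrepancy x := mul_nonneg (sq_nonneg L) (discrepancy_nonneg x)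
  -- The target exceeds what is proved by half of the σ² term and by L² times the discrepancy.
  have e : 2 * (4 * M / n + L) * (globalObj (localObj F) (mean x) - globalObj (localObj F) xs)
        + 1 / n * refVariance F xs w + (4 * L * M / n + 2 * L ^ 2) * discrepancy x =
      (2 * L * (globalObj (localObj F) (mean x) - globalObj (localObj F) xs)
        + L ^ 2 * discrepancy x) + 1 / n * (8 * M *
          (globalObj (localObj F) (mean x) - globalObj (localObj F) xs)
        + 1 / 2 * refVariance F xs w + 4 * L * M * discrepancy x)
        + (1 / 2 * (1 / n * refVariance F xs w) + L ^ 2 * discrepancy x) := by ring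
  rw [e]
  linarith

lemma Setting.integral_norm_mean_direction_sq_le (h : Setting P F L M μ xs q J B) (k : ℕ) :
    ∫ ω, ‖mean fun i => direction F i (J k i ω) (X k ω i) (W k ω i)‖ ^ 2 ∂P ≤
      2 * (4 * M / n + L) *
          ∫ ω, (globalObj (localObj F) (mean (X k ω)) - globalObj (localObj F) xs) ∂P
        + 1 / n * ∫ ω, refVariance F xs (W k ω) ∂P
        + (4 * L * M / n + 2 * L ^ 2) * ∫ ω, discrepancy (X k ω) ∂P := by
  have h1 := h.integral_eq (γ := γ) (τ := τ) (x0 := x0) (w0 := w0) k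
    (φ := fun x w j _ => ‖mean fun i => direction F i (j i) (x i) (w i)‖ ^ 2) fun _ _ => rfl
  have h2 := h.integral_le_of_forall_le (γ := γ) (τ := τ) (x0 := x0) (w0 := w0) k
    (c₄ := 0) fun x w => (h.integral_norm_mean_direction_sq_le_of_state k x w).trans_eq (add_zero _).symm
  rw [add_zero] at h2
  exact h1.trans_le h2

lemma Setting.integral_norm_mean_sub_sq_succ_le (h : Setting P F L M μ xs q J B) (hγ : 0 < γ)
    (k : ℕ) :
    ∫ ω, ‖mean (X (k + 1) ω) - xs‖ ^ 2 ∂P ≤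
      (1 - γ * μ) * ∫ ω, ‖mean (X k ω) - xs‖ ^ 2 ∂P
        + (γ ^ 2 * (2 * (4 * M / n + L)) - 2 * γ) *
          ∫ ω, (globalObj (localObj F) (mean (X k ω)) - globalObj (localObj F) xs) ∂P
        + γ ^ 2 * (1 / n) * ∫ ω, refVariance F xs (W k ω) ∂P
        + (γ ^ 2 * (4 * L * M / n + 2 * L ^ 2) + γ * L) * ∫ ω, discrepancy (X k ω) ∂P := by
  simp only [mean_iterates_succ h.n_pos]
  have h1 := h.integral_le (γ := γ) (τ := τ) (x0 := x0) (w0 := w0) k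
    (φ := fun x w j _ =>
      ‖mean x - γ • (mean fun i => direction F i (j i) (x i) (w i)) - xs‖ ^ 2)
    (ψ := fun x w => (1 - γ * μ) * ‖mean x - xs‖ ^ 2
      + ((γ ^ 2 * (2 * (4 * M / n + L)) - 2 * γ) *
          (globalObj (localObj F) (mean x) - globalObj (localObj F) xs)
        + γ ^ 2 * (1 / n) * refVariance F xs w
        + (γ ^ 2 * (4 * L * M / n + 2 * L ^ 2) + γ * L) * discrepancy x)) fun x w => by
      simp only [sub_right_comm _ (γ • _) xs]
      rw [integral_norm_sub_smul_mean_sampled_sq (h.sampling.measurable_index k)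
        (h.sampling.uniform_index k) (fun i j => direction F i j (x i) (w i))]
      simp only [h.mean_direction]
      have h2 := mul_le_mul_of_nonneg_left
        (h.integral_norm_mean_direction_sq_le_of_state k x w) (sq_nonneg γ)
      have h3 := mul_le_mul_of_nonneg_left (le_inner_mean_gradient (xs := xs) h.n_pos h.μ_nonneg
        h.smooth h.strongConvex x) hγ.le
      linarith
  refine h1.trans ?_
  rw [integral_add (h.integrable k fun x _ => (1 - γ * μ) * ‖mean x - xs‖ ^ 2)
    (h.integrable k fun x w => (γ ^ 2 * (2 * (4 * M / n + L)) - 2 * γ) *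
          (globalObj (localObj F) (mean x) - globalObj (localObj F) xs)
        + γ ^ 2 * (1 / n) * refVariance F xs w
        + (γ ^ 2 * (4 * L * M / n + 2 * L ^ 2) + γ * L) * discrepancy x),
    integral_const_mul]
  have h4 := h.integral_le_of_forall_le (γ := γ) (τ := τ) (x0 := x0) (w0 := w0) k
    (φ := fun x w => (γ ^ 2 * (2 * (4 * M / n + L)) - 2 * γ) *
          (globalObj (localObj F) (mean x) - globalObj (localObj F) xs)
        + γ ^ 2 * (1 / n) * refVariance F xs w
        + (γ ^ 2 * (4 * L * M / n + 2 * L ^ 2) + γ * L) * discrepancy x)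
    (c₄ := 0) fun x w => (add_zero _).symm.le
  linarith

lemma discrepancy_const (hn : 0 < n) (v : Vec d) : discrepancy (fun _ : Fin n => v) = 0 := by
  simp [discrepancy, mean_const hn]

omit [IsProbabilityMeasure P] in
lemma integral_discrepancy_succ_of_mod_eq_zero (hn : 0 < n) {k : ℕ} (hk : (k + 1) % τ = 0) :
    ∫ ω, discrepancy (X (k + 1) ω) ∂P = 0 := by
  simp only [iterates_succ_of_mod_eq_zero hk, discrepancy_const hn, integral_zero]

omit [IsProbabilityMeasure P] in
lemma integral_discrepancy_zero (hn : 0 < n) : ∫ ω, discrepancy (X 0 ω) ∂P = 0 := by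
  simp only [iterates_zero, discrepancy_const hn, integral_zero]

lemma Setting.integral_discrepancy_succ_le (h : Setting P F L M μ xs q J B) {k : ℕ}
    (hk : (k + 1) % τ ≠ 0) {β : ℝ} (hβ : 0 < β) :
    ∫ ω, discrepancy (X (k + 1) ω) ∂P ≤ (1 + β) * ∫ ω, discrepancy (X k ω) ∂P
      + (1 + β⁻¹) * γ ^ 2 * avg (fun i => ∫ ω, ‖∇ (localObj F i) (X k ω i)‖ ^ 2 ∂P)
      + γ ^ 2 * avg fun i => ∫ ω, ‖direction F i (J k i ω) (X k ω i) (W k ω i)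
            - ∇ (localObj F i) (X k ω i)‖ ^ 2 ∂P := by
  simp only [iterates_succ_of_mod_ne_zero hk]
  have h1 := h.integral_le (γ := γ) (τ := τ) (x0 := x0) (w0 := w0) k
    (φ := fun x w j _ => discrepancy fun i => x i - γ • direction F i (j i) (x i) (w i))
    (ψ := fun x w => (1 + β) * discrepancy x
      + (1 + β⁻¹) * γ ^ 2 * avg (fun i => ‖∇ (localObj F i) (x i)‖ ^ 2)
      + γ ^ 2 * avg fun i => discrepancy fun j => direction F i j (x i) (w i)) fun x w => by
      have := integral_discrepancy_sub_smul_sampled_le h.n_pos h.m_pos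
        (h.sampling.measurable_index k)
        (h.sampling.uniform_index k) (fun i j => direction F i j (x i) (w i)) x γ hβ
      simp only [h.mean_direction] at this
      exact this
  refine h1.trans_eq ?_
  rw [integral_add (h.integrable k fun x _ => (1 + β) * discrepancy x
      + (1 + β⁻¹) * γ ^ 2 * avg (fun i => ‖∇ (localObj F i) (x i)‖ ^ 2))
      (h.integrable k fun x w =>
        γ ^ 2 * avg fun i => discrepancy fun j => direction F i j (x i) (w i)),
    integral_add (h.integrable k fun x _ => (1 + β) * discrepancy x)
      (h.integrable k fun x _ =>
        (1 + β⁻¹) * γ ^ 2 * avg (fun i => ‖∇ (localObj F i) (x i)‖ ^ 2)),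
    integral_const_mul, integral_const_mul, integral_const_mul]
  simp only [h.integral_norm_direction_sub_sq, avg]
  rw [integral_const_mul, integral_finsetSum _ fun i _ =>
      h.integrable k fun x _ => ‖∇ (localObj F i) (x i)‖ ^ 2,
    integral_const_mul, integral_finsetSum _ fun i _ =>
      h.integrable k fun x w => discrepancy fun j => direction F i j (x i) (w i)]

/-! ### Conditional expectations -/

lemma Setting.condExp_mean_direction (h : Setting P F L M μ xs q J B) (k : ℕ) :
    P[fun ω => mean fun i => direction F i (J k i ω) (X k ω i) (W k ω i) | history J B k] =ᵐ[P]
      fun ω => mean fun i => ∇ (localObj F i) (X k ω i) :=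
  h.sampling.condExp_history F γ τ x0 w0 k
    (fun x w j => mean fun i => direction F i (j i) (x i) (w i))
    (fun x => mean fun i => ∇ (localObj F i) (x i)) fun x w => by
      have := integral_mean_sampled (h.sampling.measurable_index k)
        (h.sampling.uniform_index k) (fun i j => direction F i j (x i) (w i))
      simp only [h.mean_direction] at this
      exact this

lemma IsSmooth.continuous_gradient {f : Vec d → ℝ} (hf : IsSmooth L f) : Continuous (∇ f) :=
  (LipschitzWith.of_dist_le_mul (K := L.toNNReal) fun x y => by
    rw [dist_eq_norm, dist_eq_norm]
    exact (hf.2 x y).trans (by gcongr; exact Real.le_coe_toNNReal L)).continuous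

/-- The sigma-algebra of the local iterates is coarser than the history. By the tower property it is
enough that the conditional mean given the history is a measurable function of those iterates, which
continuity of the gradient provides. -/
lemma Setting.condMean_stochGrad (h : Setting P F L M μ xs q J B) (k : ℕ) (i : Fin n) :
    condMean P (iterate F γ τ x0 w0 J B) (stochGrad F γ τ x0 w0 J B) k i =ᵐ[P]
      fun ω => ∇ (localObj F i) (X k ω i) := by
  have hX := measurable_iterate_history F γ τ x0 w0 J B k
  have hle : MeasurableSpace.comap (X k) inferInstance ≤ history J B k := hX.comap_le
  have h1 : P[stochGrad F γ τ x0 w0 J B k i | history J B k] =ᵐ[P]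
      fun ω => ∇ (localObj F i) (X k ω i) :=
    h.sampling.condExp_history F γ τ x0 w0 k (fun x w j => direction F i (j i) (x i) (w i))
      (fun x => ∇ (localObj F i) (x i)) fun x w => by
        have := integral_sampled (h.sampling.measurable_index k)
          (h.sampling.uniform_index k) (fun i j => direction F i j (x i) (w i)) i
        simp only [h.mean_direction] at this
        exact this
  have h2 := condExp_condExp_of_le (μ := P) (f := stochGrad F γ τ x0 w0 J B k i) hle
    (h.sampling.history_le k)
  refine h2.symm.trans ((condExp_congr_ae h1).trans ?_)
  rw [condExp_of_stronglyMeasurable (hle.trans (h.sampling.history_le k)) ?_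
    (h.integrable k fun x _ => ∇ (localObj F i) (x i))]
  have hc := (h.smooth i).continuous_gradient
  have hφ : Measurable fun x : Fin n → Vec d => ∇ (localObj F i) (x i) :=
    hc.measurable.comp (measurable_pi_apply i)
  exact hφ.stronglyMeasurable.comp_measurable (comap_measurable (X k))

end Expectations

/-! ### Weighted sums of sequences satisfying recursions -/

section Weights

variable {γ μ q : ℝ}

lemma weight_pos (hη : min (γ * μ) (q / 4) < 1) (k : ℕ) : 0 < weight γ μ q k :=
  one_div_pos.2 (pow_pos (sub_pos.2 hη) _)

lemma weightSum_pos (hη : min (γ * μ) (q / 4) < 1) (K : ℕ) : 0 < weightSum γ μ q K :=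
  Finset.sum_pos (fun k _ => weight_pos hη k) ⟨0, by simp⟩

lemma weight_zero_mul (hη : min (γ * μ) (q / 4) < 1) :
    weight γ μ q 0 * (1 - min (γ * μ) (q / 4)) = 1 := by
  have := (sub_pos.2 hη).ne'
  rw [weight, zero_add, pow_one]
  field_simp

lemma weight_succ_mul (hη : min (γ * μ) (q / 4) < 1) (k : ℕ) :
    weight γ μ q (k + 1) * (1 - min (γ * μ) (q / 4)) = weight γ μ q k := by
  have := (sub_pos.2 hη).ne'
  rw [weight, weight, pow_succ _ (k + 1)]
  field_simp

/-- Weighted summation of a recursion with contraction factor `1 - min {γμ, q/4}`. -/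
lemma sum_weight_mul_le (hη : min (γ * μ) (q / 4) < 1) {T c : ℕ → ℝ} (hT : ∀ k, 0 ≤ T k)
    (h : ∀ k, T (k + 1) ≤ (1 - min (γ * μ) (q / 4)) * T k - c k) (K : ℕ) :
    ∑ k ∈ Finset.range (K + 1), weight γ μ q k * c k ≤ T 0 := by
  -- Multiplying the recursion by the weight makes it telescope. The factor 1 - min {γμ, q/4} lowers
  -- the index of the weight by one and equals the inverse of the weight at 0, so the invariant
  -- starts as an equality.
  have key : ∀ N, ∑ k ∈ Finset.range N, weight γ μ q k * c k
      + weight γ μ q N * (1 - min (γ * μ) (q / 4)) * T N ≤ T 0 := fun N => by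
    induction N with
    | zero => simp [weight_zero_mul hη]
    | succ N ih =>
      rw [Finset.sum_range_succ, weight_succ_mul hη]
      have := mul_le_mul_of_nonneg_left (h N) (weight_pos hη N).le
      linarith
  have h1 := key (K + 1)
  rw [weight_succ_mul hη] at h1
  linarith [mul_nonneg (weight_pos hη K).le (hT (K + 1))]

/-- Bernoulli's inequality: over at most `T` steps the contraction factors multiply to at least 1 -
1/16. -/
lemma weight_le_of_le {T : ℕ} (hη0 : 0 ≤ min (γ * μ) (q / 4))
    (hηT : min (γ * μ) (q / 4) < 1) (hT : T * min (γ * μ) (q / 4) ≤ 1 / 16)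
    {k l : ℕ} (hlk : l ≤ k) (hkl : k ≤ l + T) :
    weight γ μ q k ≤ 16 / 15 * weight γ μ q l := by
  obtain ⟨j, rfl⟩ := Nat.exists_eq_add_of_le hlk
  have hj : (j : ℝ) ≤ T := by exact_mod_cast (by omega : j ≤ T)
  have h1 := one_add_mul_le_pow (a := -min (γ * μ) (q / 4)) (by linarith) j
  have h2 : (j : ℝ) * min (γ * μ) (q / 4) ≤ 1 / 16 :=
    (mul_le_mul_of_nonneg_right hj hη0).trans hT
  rw [← sub_eq_add_neg 1] at h1
  have h3 : 15 / 16 ≤ (1 - min (γ * μ) (q / 4)) ^ j := by linarith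
  have h4 : 0 < (1 - min (γ * μ) (q / 4)) ^ (l + 1) := pow_pos (sub_pos.2 hηT) _
  rw [weight, weight, show l + j + 1 = (l + 1) + j by ring, pow_add, one_div, mul_inv, one_div,
    mul_comm]
  gcongr
  rw [inv_le_comm₀ (by linarith) (by norm_num)]
  norm_num at h3 ⊢
  exact h3

/-- After exchanging the sums, a fixed `l` lies in the window of at most `T` indices, namely those
in (l, l + T]. -/
lemma sum_sum_Ico_le {K T : ℕ} {g : ℕ → ℝ} (hg : ∀ l, 0 ≤ g l) :
    ∑ k ∈ Finset.range (K + 1), ∑ l ∈ Finset.Ico (k - T) k, g l ≤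
      T * ∑ l ∈ Finset.range (K + 1), g l := by
  have h1 : ∀ k ∈ Finset.range (K + 1), ∑ l ∈ Finset.Ico (k - T) k, g l =
      ∑ l ∈ Finset.range (K + 1), if l < k ∧ k ≤ l + T then g l else 0 := fun k hk => by
    rw [← Finset.sum_filter]
    congr 1
    ext l
    simp only [Finset.mem_Ico, Finset.mem_filter, Finset.mem_range] at hk ⊢
    omega
  rw [Finset.sum_congr rfl h1, Finset.sum_comm, Finset.mul_sum]
  refine Finset.sum_le_sum fun l _ => ?_
  rw [← Finset.sum_filter, Finset.sum_const, nsmul_eq_mul]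
  refine mul_le_mul_of_nonneg_right ?_ (hg l)
  have h2 : (Finset.range (K + 1)).filter (fun k => l < k ∧ k ≤ l + T) ⊆
      Finset.Ioc l (l + T) := fun k => by
    simp only [Finset.mem_filter, Finset.mem_Ioc]
    exact fun h => h.2
  have h3 := Finset.card_le_card h2
  rw [Nat.card_Ioc, Nat.add_sub_cancel_left] at h3
  exact_mod_cast h3

/-- Unrolling the recursion of the discrepancy back to the last communication round. -/
lemma le_sum_Ico_of_recursion {τ : ℕ} (hτ : 1 ≤ τ) {V a b : ℕ → ℝ}
    (ha : ∀ k, 0 ≤ a k) (hb : ∀ k, 0 ≤ b k) (h0 : V 0 = 0)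
    (hsync : ∀ k, (k + 1) % τ = 0 → V (k + 1) = 0)
    (hstep : ∀ k, (k + 1) % τ ≠ 0 → ∀ β : ℝ, 0 < β →
      V (k + 1) ≤ (1 + β) * V k + (1 + β⁻¹) * γ ^ 2 * a k + γ ^ 2 * b k) (k : ℕ) :
    V k ≤ Real.exp 1 * γ ^ 2 *
      ∑ l ∈ Finset.Ico (k - (τ - 1)) k, (((τ : ℝ) - 1) * a l + b l) := by
  have hT0 : (0 : ℝ) ≤ (τ : ℝ) - 1 := by
    rw [sub_nonneg]
    exact_mod_cast hτ
  have hnn : ∀ l, 0 ≤ ((τ : ℝ) - 1) * a l + b l := fun l =>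
    add_nonneg (mul_nonneg hT0 (ha l)) (hb l)
  -- For `τ = 1` every iteration communicates, and the choice β = 1/(τ-1) made below is not
  -- available.
  rcases hτ.eq_or_lt with rfl | hτ
  · have hV : V k = 0 := by
      cases k with
      | zero => exact h0
      | succ k => exact hsync k (Nat.mod_one _)
    rw [hV]
    exact mul_nonneg (by positivity) (Finset.sum_nonneg fun l _ => hnn l)
  set T : ℝ := (τ : ℝ) - 1 with hT
  have hTpos : 0 < T := by
    rw [hT, sub_pos]
    exact_mod_cast hτ
  -- `k - k % τ` is the last communication, where V vanishes, so the unrolled sum has no initial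
  -- term.
  have key : V k ≤ ∑ l ∈ Finset.Ico (k - k % τ) k,
      (1 + T⁻¹) ^ (k - 1 - l) * ((1 + T) * γ ^ 2 * a l + γ ^ 2 * b l) := by
    induction k with
    | zero => simp [h0]
    | succ k ih =>
      by_cases hk : (k + 1) % τ = 0
      · simp [hsync k hk, hk]
      · have h1 : (k + 1) % τ = k % τ + 1 := by
          have h5 := Nat.mod_lt k (by omega : 0 < τ)
          by_cases h6 : k % τ + 1 = τ
          · exfalso
            apply hk
            rw [Nat.add_mod, Nat.mod_eq_of_lt hτ, h6, Nat.mod_self]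
          · rw [Nat.add_mod, Nat.mod_eq_of_lt hτ, Nat.mod_eq_of_lt (by omega)]
        have h2 : k + 1 - (k + 1) % τ = k - k % τ := by omega
        rw [h2, Finset.sum_Ico_succ_top (Nat.sub_le _ _)]
        have h3 := hstep k hk T⁻¹ (by positivity)
        rw [inv_inv] at h3
        have h4 : ∑ l ∈ Finset.Ico (k - k % τ) k,
            (1 + T⁻¹) ^ (k + 1 - 1 - l) * ((1 + T) * γ ^ 2 * a l + γ ^ 2 * b l) =
            (1 + T⁻¹) * ∑ l ∈ Finset.Ico (k - k % τ) k,
            (1 + T⁻¹) ^ (k - 1 - l) * ((1 + T) * γ ^ 2 * a l + γ ^ 2 * b l) := by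
          rw [Finset.mul_sum]
          refine Finset.sum_congr rfl fun l hl => ?_
          rw [Finset.mem_Ico] at hl
          rw [← mul_assoc, ← pow_succ']
          congr 2
          omega
        rw [h4]
        have h5 : k + 1 - 1 - k = 0 := by omega
        rw [h5, pow_zero, one_mul]
        have h6 : (0 : ℝ) ≤ 1 + T⁻¹ := by positivity
        linarith [mul_le_mul_of_nonneg_left ih h6]
  have hmod : k % τ ≤ τ - 1 := Nat.le_sub_one_of_lt (Nat.mod_lt k (by omega))
  refine key.trans ?_
  rw [Finset.mul_sum]
  refine (Finset.sum_le_sum fun l hl => ?_).trans (Finset.sum_le_sum_of_subset_of_nonneg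
    (Finset.Ico_subset_Ico_left (Nat.sub_le_sub_left hmod k)) fun l _ _ =>
      mul_nonneg (by positivity) (hnn l))
  rw [Finset.mem_Ico] at hl
  have hpow : ∀ j : ℕ, j ≤ τ - 1 → (1 + T⁻¹) ^ j ≤ Real.exp 1 := fun j hj => by
    have h1 : (j : ℝ) ≤ T := by
      have : (j : ℝ) + 1 ≤ τ := by exact_mod_cast (by omega : j + 1 ≤ τ)
      linarith
    calc (1 + T⁻¹) ^ j ≤ Real.exp T⁻¹ ^ j := by
          gcongr
          linarith [Real.add_one_le_exp T⁻¹]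
      _ = Real.exp (j * T⁻¹) := (Real.exp_nat_mul _ _).symm
      _ ≤ Real.exp 1 := by
        rw [Real.exp_le_exp, ← div_eq_mul_inv]
        exact div_le_one_of_le₀ h1 hTpos.le
  have h1 := hpow (k - 1 - l) (by omega)
  have h2 := hpow (k - 1 - l + 1) (by omega)
  -- The Young factor 1 + T equals T(1 + 1/T), so it adds one to the exponent. The new exponent k -
  -- l is still at most τ - 1, and (1 + 1/T)^T ≤ e suffices.
  have h3 : (1 + T⁻¹) ^ (k - 1 - l) * (1 + T) = (1 + T⁻¹) ^ (k - 1 - l + 1) * T := by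
    rw [pow_succ]
    field_simp
    ring
  calc (1 + T⁻¹) ^ (k - 1 - l) * ((1 + T) * γ ^ 2 * a l + γ ^ 2 * b l) =
        ((1 + T⁻¹) ^ (k - 1 - l) * (1 + T)) * (γ ^ 2 * a l)
          + (1 + T⁻¹) ^ (k - 1 - l) * (γ ^ 2 * b l) := by ring
    _ = (1 + T⁻¹) ^ (k - 1 - l + 1) * (T * (γ ^ 2 * a l))
          + (1 + T⁻¹) ^ (k - 1 - l) * (γ ^ 2 * b l) := by rw [h3]; ring
    _ ≤ Real.exp 1 * (T * (γ ^ 2 * a l)) + Real.exp 1 * (γ ^ 2 * b l) := by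
      have := ha l
      have := hb l
      gcongr
    _ = _ := by ring

/-- The weighted sum of the discrepancies, from the recursions of discrepancy and variance. -/
lemma sum_weight_discrepancy_le {τ : ℕ} (hτ : 1 ≤ τ) {L M z : ℝ} (hL : 0 ≤ L) (hM : 0 ≤ M)
    (hz : 0 ≤ z) (hq : 0 < q)
    (hη0 : 0 ≤ min (γ * μ) (q / 4)) (hη : min (γ * μ) (q / 4) < 1)
    (hηT : ((τ : ℝ) - 1) * min (γ * μ) (q / 4) ≤ 1 / 16)
    (hstep : Real.exp 1 * γ ^ 2 * ((τ : ℝ) - 1) * L * (3 * L * ((τ : ℝ) - 1) + 12 * M) ≤ 1 / 32)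
    {V a b r s : ℕ → ℝ} (hr : ∀ k, 0 ≤ r k) (hs : ∀ k, 0 ≤ s k)
    (hV0 : ∀ k, 0 ≤ V k) (ha0 : ∀ k, 0 ≤ a k) (hb0 : ∀ k, 0 ≤ b k)
    (hV : ∀ k, V k ≤ Real.exp 1 * γ ^ 2 *
      ∑ l ∈ Finset.Ico (k - (τ - 1)) k, (((τ : ℝ) - 1) * a l + b l))
    (ha : ∀ k, a k ≤ 6 * L * r k + 3 * L ^ 2 * V k + 3 * z)
    (hb : ∀ k, b k ≤ 8 * M * r k + 1 / 2 * s k + 4 * L * M * V k)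
    (hss : ∀ k, s (k + 1) ≤ (1 - q) * s k + 16 * q * M * r k + 8 * q * L * M * V k) (K : ℕ) :
    2 * L * ∑ k ∈ Finset.range (K + 1), weight γ μ q k * V k ≤
      1 / 2 * ∑ k ∈ Finset.range (K + 1), weight γ μ q k * r k + 2 * L * svrgH τ q γ * s 0
        + 2 * L * svrgD₃ τ z * γ ^ 2 * weightSum γ μ q K := by
  set w := weight γ μ q with hw
  have hw0 : ∀ k, 0 ≤ w k := fun k => (weight_pos hη k).le
  set T : ℝ := (τ : ℝ) - 1 with hT
  have hTcast : ((τ - 1 : ℕ) : ℝ) = T := by rw [Nat.cast_sub hτ, Nat.cast_one]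
  have hT0 : 0 ≤ T := by
    rw [hT, sub_nonneg]
    exact_mod_cast hτ
  set A := ∑ k ∈ Finset.range (K + 1), w k * r k with hA
  set S := ∑ k ∈ Finset.range (K + 1), w k * s k with hS
  set U := ∑ k ∈ Finset.range (K + 1), w k * V k with hU
  set Ws := weightSum γ μ q K with hWs
  have hA0 : 0 ≤ A := Finset.sum_nonneg fun k _ => mul_nonneg (hw0 k) (hr k)
  have hU0 : 0 ≤ U := Finset.sum_nonneg fun k _ => mul_nonneg (hw0 k) (hV0 k)
  have hWs0 : 0 ≤ Ws := (weightSum_pos hη K).le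
  set E := Real.exp 1 with hE
  have hE0 : 0 < E := Real.exp_pos 1
  have hηq : min (γ * μ) (q / 4) ≤ q / 4 := min_le_right _ _
  -- The variance contracts by 1 - q while the weights grow at a rate of at most q/4; the surplus
  -- 3q/4 pays for the weighted sum of `s`.
  have hS1 : 3 * q / 4 * S ≤ s 0 + 16 * q * M * A + 8 * q * L * M * U := by
    have h1 := sum_weight_mul_le hη (T := s)
      (c := fun k => 3 * q / 4 * s k - 16 * q * M * r k - 8 * q * L * M * V k) hs (fun k => by
        have := mul_le_mul_of_nonneg_right hηq (hs k)
        linarith [hss k]) K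
    have h2 : ∑ k ∈ Finset.range (K + 1),
        w k * (3 * q / 4 * s k - 16 * q * M * r k - 8 * q * L * M * V k) =
        3 * q / 4 * S - 16 * q * M * A - 8 * q * L * M * U := by
      simp only [hS, hA, hU, Finset.mul_sum, ← Finset.sum_sub_distrib]
      exact Finset.sum_congr rfl fun k _ => by ring
    linarith
  have hS2 : S ≤ 4 / (3 * q) * s 0 + 64 / 3 * M * A + 32 / 3 * L * M * U := by
    have e : 3 * q / 4 * (4 / (3 * q) * s 0 + 64 / 3 * M * A + 32 / 3 * L * M * U) =
        s 0 + 16 * q * M * A + 8 * q * L * M * U := by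
      field_simp
      ring
    rw [← e] at hS1
    exact le_of_mul_le_mul_left hS1 (by positivity)
  have hh0 : ∀ l, 0 ≤ T * a l + b l := fun l => add_nonneg (mul_nonneg hT0 (ha0 l)) (hb0 l)
  -- Replacing `w k` by `w l` inside a window costs 16/15, and each `l` occurs in at most T windows.
  have hU1 : U ≤ 16 / 15 * (E * γ ^ 2 * T) *
      ∑ l ∈ Finset.range (K + 1), w l * (T * a l + b l) := by
    have h1 : ∀ k ∈ Finset.range (K + 1), w k * V k ≤
        16 / 15 * (E * γ ^ 2) * ∑ l ∈ Finset.Ico (k - (τ - 1)) k, w l * (T * a l + b l) :=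
      fun k _ => by
      calc w k * V k ≤ w k * (E * γ ^ 2 *
            ∑ l ∈ Finset.Ico (k - (τ - 1)) k, (T * a l + b l)) :=
            mul_le_mul_of_nonneg_left (hV k) (hw0 k)
        _ = E * γ ^ 2 * ∑ l ∈ Finset.Ico (k - (τ - 1)) k, w k * (T * a l + b l) := by
            rw [← Finset.mul_sum]
            ring
        _ ≤ E * γ ^ 2 * ∑ l ∈ Finset.Ico (k - (τ - 1)) k,
              16 / 15 * (w l * (T * a l + b l)) := by
            refine mul_le_mul_of_nonneg_left (Finset.sum_le_sum fun l hl => ?_) (by positivity)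
            rw [Finset.mem_Ico] at hl
            rw [← mul_assoc]
            exact mul_le_mul_of_nonneg_right (weight_le_of_le (T := τ - 1) hη0 hη
              (by rw [hTcast]; exact hηT) hl.2.le (by omega)) (hh0 l)
        _ = _ := by
            rw [← Finset.mul_sum]
            ring
    refine (Finset.sum_le_sum h1).trans ?_
    rw [← Finset.mul_sum]
    have h2 := sum_sum_Ico_le (K := K) (T := τ - 1) (g := fun l => w l * (T * a l + b l))
      fun l => mul_nonneg (hw0 l) (hh0 l)
    rw [hTcast] at h2
    have h3 : 0 ≤ 16 / 15 * (E * γ ^ 2) := by positivity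
    linarith [mul_le_mul_of_nonneg_left h2 h3]
  have hsum : ∑ l ∈ Finset.range (K + 1), w l * (T * a l + b l) ≤
      (6 * L * T + 8 * M) * A + L * (3 * L * T + 4 * M) * U + 1 / 2 * S + 3 * T * z * Ws := by
    have h1 : ∀ l ∈ Finset.range (K + 1), w l * (T * a l + b l) ≤
        (6 * L * T + 8 * M) * (w l * r l) + L * (3 * L * T + 4 * M) * (w l * V l)
          + 1 / 2 * (w l * s l) + 3 * T * z * w l := fun l _ => by
      have h2 := add_le_add (mul_le_mul_of_nonneg_left (ha l) hT0) (hb l)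
      refine (mul_le_mul_of_nonneg_left h2 (hw0 l)).trans_eq ?_
      ring
    refine (Finset.sum_le_sum h1).trans_eq ?_
    simp only [Finset.sum_add_distrib, ← Finset.mul_sum]
    rfl
  -- Half of the bound on `S` raises 8M to 56M/3 and 4M to 28M/3.
  have hU2 : U ≤ 16 / 15 * (E * γ ^ 2 * T) * ((6 * L * T + 56 / 3 * M) * A
      + L * (3 * L * T + 28 / 3 * M) * U + 2 / (3 * q) * s 0 + 3 * T * z * Ws) := by
    refine hU1.trans (mul_le_mul_of_nonneg_left (hsum.trans ?_) (by positivity))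
    have e : 4 / (3 * q) * s 0 = 2 * (2 / (3 * q) * s 0) := by ring
    linarith
  set κ := E * γ ^ 2 * T * L with hκ
  have hκ0 : 0 ≤ κ := by positivity
  have hp : 0 ≤ κ * (L * T) := by positivity
  have hm : 0 ≤ κ * M := by positivity
  have hbound : 3 * (κ * (L * T)) + 12 * (κ * M) ≤ 1 / 32 := by
    refine Eq.trans_le ?_ hstep
    rw [hκ]
    ring
  have hLU : L * U ≤ 16 / 15 * ((6 * (κ * (L * T)) + 56 / 3 * (κ * M)) * A)
      + 16 / 15 * ((3 * (κ * (L * T)) + 28 / 3 * (κ * M)) * (L * U))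
      + 16 / 15 * (2 / 3 * (κ / q * s 0)) + 16 / 15 * (3 * (κ * T * z * Ws)) := by
    refine (mul_le_mul_of_nonneg_left hU2 hL).trans_eq ?_
    rw [hκ]
    field_simp
  -- Since 28/3 ≤ 12, the coefficient of `L * U` is at most 1/32 and that of `A`, being twice as
  -- large, at most 1/16. Solving for `L * U` then leaves room in all the constants.
  have h1 : (6 * (κ * (L * T)) + 56 / 3 * (κ * M)) * A ≤ 1 / 16 * A :=
    mul_le_mul_of_nonneg_right (by linarith) hA0
  have h2 : (3 * (κ * (L * T)) + 28 / 3 * (κ * M)) * (L * U) ≤ 1 / 32 * (L * U) :=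
    mul_le_mul_of_nonneg_right (by linarith) (by positivity)
  have h3 : 0 ≤ κ / q * s 0 := mul_nonneg (by positivity) (hs 0)
  have h4 : 0 ≤ κ * T * z * Ws := by positivity
  have h5 : 2 * L * svrgH τ q γ * s 0 = 8 * (κ / q * s 0) + 4 * (κ * s 0) := by
    rw [svrgH, hκ]
    field_simp
    ring
  have h6 : 2 * L * svrgD₃ τ z * γ ^ 2 * Ws = 12 * (κ * T * z * Ws) := by
    rw [svrgD₃, hκ]
    ring
  have h7 : 0 ≤ κ * s 0 := mul_nonneg hκ0 (hs 0)
  rw [h5, h6]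
  linarith

end Weights

/-! ### Consequences of the stepsize bounds -/

section Stepsize

variable {n τ : ℕ} {L M μ q γ : ℝ}

lemma StepsizeOK.mul_le (hγ : StepsizeOK n τ L M q γ) (hL : 0 ≤ L) (hM : 0 ≤ M) (hγ0 : 0 < γ)
    (hτ : 1 ≤ τ) (hq0 : 0 < q) (hq1 : q < 1) :
    Real.exp 1 * γ ^ 2 * ((τ : ℝ) - 1) * L * (3 * L * ((τ : ℝ) - 1) + 12 * M) ≤ 1 / 32 := by
  have h1 := hγ.2
  have hT : 0 ≤ (τ : ℝ) - 1 := by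
    rw [sub_nonneg]
    exact_mod_cast hτ
  set T := (τ : ℝ) - 1
  have hE : 0 < Real.exp 1 := Real.exp_pos 1
  set E := Real.exp 1
  -- Only this weakening of the term with 1 - q is used; squaring the stepsize bound then gives
  -- 1/32.
  have hM1 : 8 * M ≤ 8 * M / (1 - q) :=
    le_div_self (by positivity) (sub_pos.2 hq1) (by linarith)
  set Q := 2 * E * L * T * (3 * L * T + 4 * M + 8 * M / (1 - q)) with hQ
  have h3 : 2 * E * L * T * (3 * L * T + 12 * M) ≤ Q :=
    mul_le_mul_of_nonneg_left (by linarith) (by positivity)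
  have h2 : 0 ≤ Q := h3.trans' (by positivity)
  have h4 : (γ * (4 * √Q)) ^ 2 ≤ 1 := pow_le_one₀ (by positivity) h1
  have h5 : (γ * (4 * √Q)) ^ 2 = 16 * γ ^ 2 * Q := by
    rw [mul_pow, mul_pow, Real.sq_sqrt h2]
    ring
  rw [h5] at h4
  have h6 := mul_le_mul_of_nonneg_left h3 (by positivity : 0 ≤ 16 * γ ^ 2)
  linarith

lemma StepsizeOK.mul_min_le (hγ : StepsizeOK n τ L M q γ) (hL : 0 ≤ L) (hM : 0 ≤ M)
    (hγ0 : 0 < γ) (hτ : 1 ≤ τ) (hq0 : 0 < q) (hq1 : q < 1) (hμL : μ ≤ L) :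
    ((τ : ℝ) - 1) * min (γ * μ) (q / 4) ≤ 1 / 16 := by
  have h1 := hγ.mul_le hL hM hγ0 hτ hq0 hq1
  have hT : 0 ≤ (τ : ℝ) - 1 := by
    rw [sub_nonneg]
    exact_mod_cast hτ
  set T := (τ : ℝ) - 1
  have hE : 27 / 10 ≤ Real.exp 1 := by linarith [Real.exp_one_gt_d9]
  have h2 : T * min (γ * μ) (q / 4) ≤ T * (γ * L) :=
    mul_le_mul_of_nonneg_left ((min_le_left _ _).trans (by gcongr)) hT
  refine h2.trans (abs_le_of_sq_le_sq' ?_ (by norm_num)).2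
  -- Keeping only the term 3LT gives 3e(TγL)² ≤ 1/32. As 96 · 27/10 > 256, this forces TγL ≤ 1/16.
  have h3 : 27 / 10 * (3 * (T * (γ * L)) ^ 2) ≤ Real.exp 1 * (3 * (T * (γ * L)) ^ 2) :=
    mul_le_mul_of_nonneg_right hE (by positivity)
  have h4 : 0 ≤ Real.exp 1 * γ ^ 2 * T * L * (12 * M) := by positivity
  linarith

end Stepsize

/-! ### Convergence -/

section Convergence

variable {Ω : Type*} [MeasurableSpace Ω] {P : Measure Ω} [IsProbabilityMeasure P] {d n m : ℕ}
  {F : Fin n → Fin m → Vec d → ℝ} {L M μ : ℝ} {xs : Vec d} {q : ℝ}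
  {J : ℕ → Fin n → Ω → Fin m} {B : ℕ → Fin n → Ω → Bool}
  {γ : ℝ} {τ : ℕ} {x0 : Vec d} {w0 : Fin n → Vec d}

local notation "X" => iterates F γ τ x0 w0 J B
local notation "W" => refPoints F γ τ x0 w0 J B

lemma zetaStarSq_nonneg {f : Fin n → Vec d → ℝ} : 0 ≤ zetaStarSq f xs :=
  avg_nonneg fun _ => sq_nonneg _

omit [IsProbabilityMeasure P] in
lemma Setting.min_lt_one (h : Setting P F L M μ xs q J B) : min (γ * μ) (q / 4) < 1 :=
  (min_le_right _ _).trans_lt (by linarith [h.q_lt_one])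

omit [IsProbabilityMeasure P] in
lemma Setting.min_nonneg (h : Setting P F L M μ xs q J B) (hγ0 : 0 < γ) :
    0 ≤ min (γ * μ) (q / 4) :=
  le_min (mul_nonneg hγ0.le h.μ_nonneg) (by linarith [h.q_pos])

omit [IsProbabilityMeasure P] in
lemma Setting.svrgH_nonneg (h : Setting P F L M μ xs q J B) (hτ : 1 ≤ τ) : 0 ≤ svrgH τ q γ := by
  have hT : 0 ≤ (τ : ℝ) - 1 := by
    rw [sub_nonneg]
    exact_mod_cast hτ
  have := h.q_pos
  unfold svrgH
  positivity

lemma svrgD₃_nonneg {z : ℝ} (hz : 0 ≤ z) : 0 ≤ svrgD₃ τ z := by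
  unfold svrgD₃
  positivity

lemma Setting.sum_discrepancy (h : Setting P F L M μ xs q J B) (hτ : 1 ≤ τ) (hγ0 : 0 < γ)
    (hγ : StepsizeOK n τ L M q γ) (K : ℕ) :
    2 * L * ∑ k ∈ Finset.range (K + 1), weight γ μ q k * ∫ ω, discrepancy (X k ω) ∂P ≤
      1 / 2 * ∑ k ∈ Finset.range (K + 1), weight γ μ q k *
          ∫ ω, (globalObj (localObj F) (mean (X k ω)) - globalObj (localObj F) xs) ∂P
        + 2 * L * svrgH τ q γ * ∫ ω, refVariance F xs (W 0 ω) ∂P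
        + 2 * L * svrgD₃ τ (zetaStarSq (localObj F) xs) * γ ^ 2 * weightSum γ μ q K := by
  have hη := h.min_lt_one (γ := γ)
  have hL := h.L_nonneg
  have hr : ∀ k, 0 ≤
      ∫ ω, (globalObj (localObj F) (mean (X k ω)) - globalObj (localObj F) xs) ∂P := fun k =>
    integral_nonneg fun ω => h.gap_nonneg _
  have hs : ∀ k, 0 ≤ ∫ ω, refVariance F xs (W k ω) ∂P := fun k =>
    integral_nonneg fun ω => refVariance_nonneg _
  rcases subsingleton_or_nontrivial (Vec d) with hd | hd
  -- In dimension 0 the comparison μ ≤ L may fail, but there is no discrepancy.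
  · have h1 : ∀ x : Fin n → Vec d, discrepancy x = 0 := fun x => by
      rw [Subsingleton.elim x fun _ => 0, discrepancy_const h.n_pos]
    have h2 : 0 ≤ ∑ k ∈ Finset.range (K + 1), weight γ μ q k *
        ∫ ω, (globalObj (localObj F) (mean (X k ω)) - globalObj (localObj F) xs) ∂P :=
      Finset.sum_nonneg fun k _ => mul_nonneg (weight_pos hη k).le (hr k)
    have h3 := h.svrgH_nonneg (γ := γ) hτ
    have h4 := svrgD₃_nonneg (τ := τ) (zetaStarSq_nonneg (f := localObj F) (xs := xs))
    have h5 := hs 0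
    have h6 := (weightSum_pos hη K).le
    simp only [h1, integral_zero, mul_zero, Finset.sum_const_zero]
    positivity
  · have hμL : μ ≤ L := le_of_strongConvexOn_of_isSmooth (h.smooth ⟨0, h.n_pos⟩)
      (h.strongConvex ⟨0, h.n_pos⟩)
    have ha0 : ∀ k, 0 ≤ avg (fun i => ∫ ω, ‖∇ (localObj F i) (X k ω i)‖ ^ 2 ∂P) := fun k =>
      avg_nonneg fun i => integral_nonneg fun ω => sq_nonneg _
    have hb0 : ∀ k, 0 ≤ avg (fun i => ∫ ω, ‖direction F i (J k i ω) (X k ω i) (W k ω i)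
        - ∇ (localObj F i) (X k ω i)‖ ^ 2 ∂P) := fun k =>
      avg_nonneg fun i => integral_nonneg fun ω => sq_nonneg _
    exact sum_weight_discrepancy_le hτ hL h.M_nonneg zetaStarSq_nonneg h.q_pos
      (h.min_nonneg hγ0) hη (hγ.mul_min_le hL h.M_nonneg hγ0 hτ h.q_pos h.q_lt_one hμL)
      (hγ.mul_le hL h.M_nonneg hγ0 hτ h.q_pos h.q_lt_one) hr hs
      (fun k => integral_nonneg fun ω => discrepancy_nonneg _) ha0 hb0
      (le_sum_Ico_of_recursion hτ ha0 hb0 (integral_discrepancy_zero h.n_pos)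
        (fun k hk => integral_discrepancy_succ_of_mod_eq_zero h.n_pos hk)
        fun k hk β hβ => h.integral_discrepancy_succ_le hk hβ)
      h.avg_integral_norm_gradient_sq_le h.avg_integral_norm_direction_sub_sq_le
      h.integral_sigma_succ_le K

/-- The weighted sum of the expected suboptimalities. -/
lemma Setting.sum_gap_le (h : Setting P F L M μ xs q J B) (hτ : 1 ≤ τ) (hγ0 : 0 < γ)
    (hγ : StepsizeOK n τ L M q γ) (K : ℕ) :
    γ * ∑ k ∈ Finset.range (K + 1), weight γ μ q k *
        ∫ ω, (globalObj (localObj F) (mean (X k ω)) - globalObj (localObj F) xs) ∂P ≤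
      Phi0 n τ L q γ ‖x0 - xs‖ (refVariance F xs w0)
        + 24 * Real.exp 1 * L * ((τ : ℝ) - 1) ^ 2 * zetaStarSq (localObj F) xs * γ ^ 2
          * (γ * weightSum γ μ q K) := by
  have hη := h.min_lt_one (γ := γ)
  have hL := h.L_nonneg
  have hM := h.M_nonneg
  have hq := h.q_pos
  have hn : (0 : ℝ) < n := by exact_mod_cast h.n_pos
  have hdisc := h.sum_discrepancy (x0 := x0) (w0 := w0) hτ hγ0 hγ K
  set R : ℕ → ℝ := fun k => ∫ ω, ‖mean (X k ω) - xs‖ ^ 2 ∂P with hR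
  set r : ℕ → ℝ := fun k =>
    ∫ ω, (globalObj (localObj F) (mean (X k ω)) - globalObj (localObj F) xs) ∂P with hr
  set s : ℕ → ℝ := fun k => ∫ ω, refVariance F xs (W k ω) ∂P with hs
  set V : ℕ → ℝ := fun k => ∫ ω, discrepancy (X k ω) ∂P with hV
  have hR0 : ∀ k, 0 ≤ R k := fun k => integral_nonneg fun ω => sq_nonneg _
  have hr0 : ∀ k, 0 ≤ r k := fun k => integral_nonneg fun ω => h.gap_nonneg _
  have hs0 : ∀ k, 0 ≤ s k := fun k => integral_nonneg fun ω => refVariance_nonneg _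
  have hV0 : ∀ k, 0 ≤ V k := fun k => integral_nonneg fun ω => discrepancy_nonneg _
  have hRec : ∀ k, R (k + 1) ≤ (1 - γ * μ) * R k
      + (γ ^ 2 * (2 * (4 * M / n + L)) - 2 * γ) * r k + γ ^ 2 * (1 / n) * s k
      + (γ ^ 2 * (4 * L * M / n + 2 * L ^ 2) + γ * L) * V k :=
    h.integral_norm_mean_sub_sq_succ_le hγ0
  have sRec : ∀ k, s (k + 1) ≤ (1 - q) * s k + 16 * q * M * r k + 8 * q * L * M * V k :=
    h.integral_sigma_succ_le
  have hRz : R 0 = ‖x0 - xs‖ ^ 2 := by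
    simp only [hR, iterates_zero, mean_const h.n_pos]
    simp
  have hsz : s 0 = refVariance F xs w0 := by
    have : ∀ ω, W 0 ω = w0 := fun _ => rfl
    simp only [hs, this]
    simp
  have hγ1 : γ * (88 * (M / n) + 2 * L) ≤ 1 := by
    refine Eq.trans_le ?_ hγ.1
    ring
  have hN : 0 ≤ M / n := by positivity
  -- Chosen so that the noise γ²/n in the distance recursion equals 3q/4 times `c`: the coefficient
  -- of σ² becomes c(1 - q/4).
  set c := 4 / (3 * n * q) * γ ^ 2 with hc
  have hc0 : 0 ≤ c := by positivity
  have h1 := sum_weight_mul_le hη (T := fun k => R k + c * s k)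
    (c := fun k => γ * r k - 2 * γ * L * V k)
    (fun k => add_nonneg (hR0 k) (mul_nonneg hc0 (hs0 k))) (fun k => by
      have e1 : c * (16 * q * M) = 64 / 3 * γ ^ 2 * (M / n) := by
        rw [hc]
        field_simp
        ring
      have e2 : c * (8 * q * L * M) = 32 / 3 * γ ^ 2 * L * (M / n) := by
        rw [hc]
        field_simp
        ring
      have e3 : γ ^ 2 * (1 / n) = c * (3 / 4 * q) := by
        rw [hc]
        field_simp
      have h2 := hRec k
      have h3 := mul_le_mul_of_nonneg_left (sRec k) hc0
      have h4 : c * ((1 - q) * s k + 16 * q * M * r k + 8 * q * L * M * V k) =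
          c * (1 - q) * s k + 64 / 3 * γ ^ 2 * (M / n) * r k
            + 32 / 3 * γ ^ 2 * L * (M / n) * V k := by
        rw [← e1, ← e2]
        ring
      rw [h4] at h3
      rw [e3] at h2
      have h5 := mul_le_mul_of_nonneg_right (min_le_left (γ * μ) (q / 4)) (hR0 k)
      have h6 := mul_le_mul_of_nonneg_right (min_le_right (γ * μ) (q / 4))
        (mul_nonneg hc0 (hs0 k))
      -- The coefficient of `r` is γ²(88M/(3n) + 2L) - 2γ, and that of `V` is γL(1 + γ(44M/(3n) +
      -- 2L)). The first stepsize bound makes them at most -γ and 2γL.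
      have h7 : γ * (88 * (M / n) + 2 * L) * (γ * r k) ≤ 1 * (γ * r k) :=
        mul_le_mul_of_nonneg_right hγ1 (mul_nonneg hγ0.le (hr0 k))
      have h8 : γ * (88 * (M / n) + 2 * L) * (γ * L * V k) ≤ 1 * (γ * L * V k) :=
        mul_le_mul_of_nonneg_right hγ1 (mul_nonneg (mul_nonneg hγ0.le hL) (hV0 k))
      have h9 : 0 ≤ γ ^ 2 * (M / n) * r k := mul_nonneg (by positivity) (hr0 k)
      have h10 : 0 ≤ γ ^ 2 * (M / n) * L * V k := mul_nonneg (by positivity) (hV0 k)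
      have e4 : (γ ^ 2 * (2 * (4 * M / n + L)) - 2 * γ) * r k =
          8 * (γ ^ 2 * (M / n) * r k) + 2 * γ ^ 2 * L * r k - 2 * γ * r k := by ring
      have e5 : (γ ^ 2 * (4 * L * M / n + 2 * L ^ 2) + γ * L) * V k =
          4 * (γ ^ 2 * (M / n) * L * V k) + 2 * γ ^ 2 * L ^ 2 * V k + γ * L * V k := by ring
      rw [e4, e5] at h2
      linarith) K
  have h2 : ∑ k ∈ Finset.range (K + 1), weight γ μ q k * (γ * r k - 2 * γ * L * V k) =
      γ * ∑ k ∈ Finset.range (K + 1), weight γ μ q k * r k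
        - γ * (2 * L * ∑ k ∈ Finset.range (K + 1), weight γ μ q k * V k) := by
    simp only [Finset.mul_sum, ← Finset.sum_sub_distrib]
    exact Finset.sum_congr rfl fun k _ => by ring
  rw [h2] at h1
  have h3 := mul_le_mul_of_nonneg_left hdisc hγ0.le
  change γ * (2 * L * ∑ k ∈ Finset.range (K + 1), weight γ μ q k * V k) ≤
    γ * (1 / 2 * ∑ k ∈ Finset.range (K + 1), weight γ μ q k * r k + 2 * L * svrgH τ q γ * s 0
      + 2 * L * svrgD₃ τ (zetaStarSq (localObj F) xs) * γ ^ 2 * weightSum γ μ q K) at h3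
  -- The discrepancy bound returns half of the sum of `r`, so everything is doubled: twice the
  -- initial value of R + c s, plus the contribution of `svrgH`.
  have h4 : Phi0 n τ L q γ ‖x0 - xs‖ (refVariance F xs w0) =
      2 * (R 0 + c * s 0) + 4 * γ * L * svrgH τ q γ * s 0 := by
    rw [hRz, hsz, Phi0, hc, svrgH]
    ring
  rw [h4]
  unfold svrgD₃ at h3
  change γ * ∑ k ∈ Finset.range (K + 1), weight γ μ q k * r k ≤ _
  linarith

lemma convexOn_globalObj {f : Fin n → Vec d → ℝ} (hf : ∀ i, ConvexOn ℝ Set.univ (f i)) :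
    ConvexOn ℝ Set.univ (globalObj f) := by
  refine ⟨convex_univ, fun x _ y _ a b ha hb hab => ?_⟩
  have h1 := avg_mono fun i => (hf i).2 (Set.mem_univ x) (Set.mem_univ y) ha hb hab
  simp only [smul_eq_mul, avg_add, avg_mul_left] at h1
  exact h1

omit [IsProbabilityMeasure P] in
/-- Jensen's inequality for the weighted average of the iterates. -/
lemma Setting.gap_weightedAvg_le (h : Setting P F L M μ xs q J B) (y : ℕ → Vec d) (K : ℕ) :
    globalObj (localObj F) (weightedAvg γ μ q y K) - globalObj (localObj F) xs ≤
      (weightSum γ μ q K)⁻¹ * ∑ k ∈ Finset.range (K + 1), weight γ μ q k *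
        (globalObj (localObj F) (y k) - globalObj (localObj F) xs) := by
  have hη := h.min_lt_one (γ := γ)
  have hW := weightSum_pos hη K
  have h1 : ∑ k ∈ Finset.range (K + 1), (weightSum γ μ q K)⁻¹ * weight γ μ q k = 1 := by
    rw [← Finset.mul_sum]
    exact inv_mul_cancel₀ hW.ne'
  have h2 := (convexOn_globalObj h.convex).map_sum_le (t := Finset.range (K + 1))
    (w := fun k => (weightSum γ μ q K)⁻¹ * weight γ μ q k) (p := y)
    (fun k _ => mul_nonneg (inv_nonneg.2 hW.le) (weight_pos hη k).le) h1
    fun k _ => Set.mem_univ _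
  have h3 : weightedAvg γ μ q y K =
      ∑ k ∈ Finset.range (K + 1), ((weightSum γ μ q K)⁻¹ * weight γ μ q k) • y k := by
    simp only [weightedAvg, Finset.smul_sum, smul_smul, one_div]
  rw [h3]
  have h4 : (weightSum γ μ q K)⁻¹ * ∑ k ∈ Finset.range (K + 1), weight γ μ q k *
        (globalObj (localObj F) (y k) - globalObj (localObj F) xs) =
      ∑ k ∈ Finset.range (K + 1),
        ((weightSum γ μ q K)⁻¹ * weight γ μ q k) • globalObj (localObj F) (y k)
        - (∑ k ∈ Finset.range (K + 1), (weightSum γ μ q K)⁻¹ * weight γ μ q k)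
          * globalObj (localObj F) xs := by
    rw [Finset.mul_sum, Finset.sum_mul, ← Finset.sum_sub_distrib]
    exact Finset.sum_congr rfl fun k _ => by rw [smul_eq_mul]; ring
  rw [h4, h1, one_mul]
  exact sub_le_sub_right h2 _

/-- The average involves the states of several iterations, so integrability at a single iteration
does not apply directly. The gap is nonnegative and dominated, by Jensen, by an integrable weighted
sum. -/
lemma Setting.integrable_gap_weightedAvg (h : Setting P F L M μ xs q J B) (K : ℕ) :
    Integrable (fun ω => globalObj (localObj F)
      (weightedAvg γ μ q (fun k => mean (X k ω)) K) - globalObj (localObj F) xs) P := by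
  have hc : Continuous (globalObj (localObj F)) :=
    continuous_const.mul (continuous_finsetSum _ fun i _ => (h.smooth i).1.continuous)
  have hm : AEStronglyMeasurable
      (fun ω => weightedAvg γ μ q (fun k => mean (X k ω)) K) P :=
    ((integrable_finsetSum (Finset.range (K + 1)) fun k _ =>
      (h.integrable k fun x _ => mean x).smul (weight γ μ q k)).smul
        (1 / weightSum γ μ q K)).aestronglyMeasurable
  have hint : Integrable (fun ω => (weightSum γ μ q K)⁻¹ * ∑ k ∈ Finset.range (K + 1),
      weight γ μ q k *
        (globalObj (localObj F) (mean (X k ω)) - globalObj (localObj F) xs)) P :=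
    (integrable_finsetSum _ fun k _ => (h.integrable k fun x _ =>
      globalObj (localObj F) (mean x) - globalObj (localObj F) xs).const_mul _).const_mul _
  refine hint.mono' ((hc.comp_aestronglyMeasurable hm).sub aestronglyMeasurable_const)
    (Filter.Eventually.of_forall fun ω => ?_)
  rw [Real.norm_of_nonneg (h.gap_nonneg _)]
  exact h.gap_weightedAvg_le _ K

lemma Setting.integral_gap_weightedAvg_le (h : Setting P F L M μ xs q J B) (hτ : 1 ≤ τ)
    (hγ0 : 0 < γ) (hγ : StepsizeOK n τ L M q γ) (K : ℕ) :
    ∫ ω, (globalObj (localObj F) (weightedAvg γ μ q (fun k => mean (X k ω)) K)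
        - globalObj (localObj F) xs) ∂P ≤
      Phi0 n τ L q γ ‖x0 - xs‖ (refVariance F xs w0) / (γ * weightSum γ μ q K)
        + 24 * Real.exp 1 * L * ((τ : ℝ) - 1) ^ 2 * zetaStarSq (localObj F) xs * γ ^ 2 := by
  have hW := weightSum_pos (h.min_lt_one (γ := γ)) K
  have hi : ∀ k, Integrable (fun ω => weight γ μ q k *
      (globalObj (localObj F) (mean (X k ω)) - globalObj (localObj F) xs)) P := fun k =>
    (h.integrable k fun x _ =>
      globalObj (localObj F) (mean x) - globalObj (localObj F) xs).const_mul _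
  have h1 := integral_mono (h.integrable_gap_weightedAvg K)
    ((integrable_finsetSum (Finset.range (K + 1)) fun k _ => hi k).const_mul
      (weightSum γ μ q K)⁻¹) fun ω => h.gap_weightedAvg_le (fun k => mean (X k ω)) K
  refine h1.trans ?_
  rw [integral_const_mul, integral_finsetSum _ fun k _ => hi k]
  simp only [integral_const_mul]
  have h2 := h.sum_gap_le (x0 := x0) (w0 := w0) hτ hγ0 hγ K
  have hγW : 0 < γ * weightSum γ μ q K := mul_pos hγ0 hW
  rw [← sub_le_iff_le_add, le_div_iff₀ hγW, sub_mul]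
  rw [← sub_le_iff_le_add] at h2
  refine Eq.trans_le ?_ h2
  field_simp

omit [IsProbabilityMeasure P] in
lemma Setting.phi0_nonneg (h : Setting P F L M μ xs q J B) (hτ : 1 ≤ τ) (hγ0 : 0 < γ) :
    0 ≤ Phi0 n τ L q γ ‖x0 - xs‖ (refVariance F xs w0) := by
  have hT : 0 ≤ (τ : ℝ) - 1 := by
    rw [sub_nonneg]
    exact_mod_cast hτ
  have h1 := h.q_pos
  have h2 := h.L_nonneg
  have h3 := refVariance_nonneg (F := F) (xs := xs) w0
  unfold Phi0
  positivity

omit [IsProbabilityMeasure P] in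
lemma Setting.div_weightSum_le_pow_mul (h : Setting P F L M μ xs q J B) (hτ : 1 ≤ τ)
    (hγ0 : 0 < γ) (K : ℕ) :
    Phi0 n τ L q γ ‖x0 - xs‖ (refVariance F xs w0) / (γ * weightSum γ μ q K) ≤
      (1 - min (γ * μ) (q / 4)) ^ K *
        (Phi0 n τ L q γ ‖x0 - xs‖ (refVariance F xs w0) / γ) := by
  have hη := h.min_lt_one (γ := γ)
  have hη0 := h.min_nonneg hγ0
  have hW := weightSum_pos hη K
  have h1 : weight γ μ q K ≤ weightSum γ μ q K :=
    Finset.single_le_sum (f := weight γ μ q) (fun k _ => (weight_pos hη k).le) (by simp)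
  have hpos : 0 < 1 - min (γ * μ) (q / 4) := sub_pos.2 hη
  have h2 : (weightSum γ μ q K)⁻¹ ≤ (1 - min (γ * μ) (q / 4)) ^ K := by
    -- The sum is bounded below by its last weight, whose inverse has exponent K + 1; one factor is
    -- given away.
    refine (inv_anti₀ (weight_pos hη K) h1).trans ?_
    rw [weight, one_div, inv_inv]
    exact pow_le_pow_of_le_one hpos.le (by linarith) (Nat.le_succ K)
  have h3 := mul_le_mul_of_nonneg_right h2
    (div_nonneg (h.phi0_nonneg (x0 := x0) (w0 := w0) hτ hγ0) hγ0.le)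
  refine Eq.trans_le ?_ h3
  field_simp

omit [IsProbabilityMeasure P] in
lemma Setting.div_weightSum_le_div (h : Setting P F L M μ xs q J B) (hτ : 1 ≤ τ)
    (hγ0 : 0 < γ) (hμ : μ = 0) {K : ℕ} (hK : 1 ≤ K) :
    Phi0 n τ L q γ ‖x0 - xs‖ (refVariance F xs w0) / (γ * weightSum γ μ q K) ≤
      Phi0 n τ L q γ ‖x0 - xs‖ (refVariance F xs w0) / (γ * K) := by
  have hq := h.q_pos
  -- For μ = 0 all the weights equal 1.
  have h1 : weightSum γ μ q K = K + 1 := by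
    have h2 : min (0 : ℝ) (q / 4) = 0 := min_eq_left (by positivity)
    simp [weightSum, weight, hμ, h2]
  have hK0 : (0 : ℝ) < K := by exact_mod_cast hK
  rw [h1]
  exact div_le_div_of_nonneg_left (h.phi0_nonneg hτ hγ0) (by positivity) (by gcongr; linarith)

/-! ### The assumptions of the general theory -/

lemma Setting.momentBounds (h : Setting P F L M μ xs q J B) :
    MomentBounds P (localObj F) xs
      (iterate F γ τ x0 w0 J B) (stochGrad F γ τ x0 w0 J B) (sigmaSq F γ τ x0 w0 J B xs)
      (svrgMoment n L M q (zetaStarSq (localObj F) xs)) where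
  admissible := by
    have hL := h.L_nonneg
    have hM := h.M_nonneg
    have hq := h.q_pos
    have hz := zetaStarSq_nonneg (f := localObj F) (xs := xs)
    constructor <;> simp only [svrgMoment] <;> first | positivity | linarith [h.q_lt_one]
  sigma_nonneg := fun k ω => refVariance_nonneg _
  integrable_obj := fun k => h.integrable k fun x _ => globalObj (localObj F) (mean x)
  integrable_sigma := fun k => h.integrable k fun _ w => refVariance F xs w
  integrable_V := fun k => h.integrable k fun x _ => discrepancy x
  integrable_grad_sq := fun k i => h.sampling.integrable F γ τ x0 w0 k
    fun x w j _ => ‖direction F i (j i) (x i) (w i)‖ ^ 2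
  integrable_mean_sq := fun k => h.sampling.integrable F γ τ x0 w0 k
    fun x w j _ => ‖mean fun i => direction F i (j i) (x i) (w i)‖ ^ 2
  second_moment := fun k => h.avg_integral_norm_direction_sq_le k
  second_moment_mean := fun k =>
    (h.integral_norm_mean_direction_sq_le k).trans_eq (add_zero _).symm
  sigma_recursion := fun k => (h.integral_sigma_succ_le k).trans_eq (by
    simp only [svrgMoment, sigmaSq]
    ring)

lemma Setting.heteroAssumption (h : Setting P F L M μ xs q J B) :
    HeteroAssumption P (localObj F) xs
      (iterate F γ τ x0 w0 J B) (stochGrad F γ τ x0 w0 J B) (sigmaSq F γ τ x0 w0 J B xs)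
      (svrgMoment n L M q (zetaStarSq (localObj F) xs))
      (svrgHetero L M (zetaStarSq (localObj F) xs)) := by
  have hc := h.condMean_stochGrad (γ := γ) (τ := τ) (x0 := x0) (w0 := w0)
  have h1 : ∀ k i,
      (fun ω => ‖condMean P (iterate F γ τ x0 w0 J B) (stochGrad F γ τ x0 w0 J B) k i ω‖ ^ 2)
        =ᵐ[P] fun ω => ‖∇ (localObj F i) (X k ω i)‖ ^ 2 := fun k i => by
    filter_upwards [hc k i] with ω hω
    rw [hω]
  have h2 : ∀ k i, (fun ω => ‖stochGrad F γ τ x0 w0 J B k i ω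
      - condMean P (iterate F γ τ x0 w0 J B) (stochGrad F γ τ x0 w0 J B) k i ω‖ ^ 2)
        =ᵐ[P] fun ω => ‖direction F i (J k i ω) (X k ω i) (W k ω i)
          - ∇ (localObj F i) (X k ω i)‖ ^ 2 := fun k i => by
    filter_upwards [hc k i] with ω hω
    rw [hω]
    rfl
  refine ⟨h.momentBounds, ?_, fun k i => ?_, fun k i => ?_, fun k => ?_, fun k => ?_⟩
  · have hL := h.L_nonneg
    have hM := h.M_nonneg
    have hz := zetaStarSq_nonneg (f := localObj F) (xs := xs)
    constructor <;> simp only [svrgHetero] <;> positivity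
  · exact (h.integrable k fun x _ => ‖∇ (localObj F i) (x i)‖ ^ 2).congr (h1 k i).symm
  · exact (h.sampling.integrable F γ τ x0 w0 k fun x w j _ =>
      ‖direction F i (j i) (x i) (w i) - ∇ (localObj F i) (x i)‖ ^ 2).congr (h2 k i).symm
  · simp only [integral_congr_ae (h1 k _)]
    refine (h.avg_integral_norm_gradient_sq_le k).trans_eq ?_
    simp only [svrgHetero]
    ring
  · simp only [integral_congr_ae (h2 k _)]
    refine (h.avg_integral_norm_direction_sub_sq_le k).trans_eq ?_
    simp only [svrgHetero, sigmaSq]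
    ring

lemma Setting.keyAssumption (h : Setting P F L M μ xs q J B) (hτ : 1 ≤ τ)
    (hγ0 : 0 < γ) (hγ : StepsizeOK n τ L M q γ) :
    KeyAssumption P (localObj F) xs
      (iterate F γ τ x0 w0 J B) (stochGrad F γ τ x0 w0 J B) (sigmaSq F γ τ x0 w0 J B xs)
      (history J B) L μ γ (svrgMoment n L M q (zetaStarSq (localObj F) xs))
      (svrgH τ q γ) (svrgD₃ τ (zetaStarSq (localObj F) xs)) where
  toMomentBounds := h.momentBounds
  H_nonneg := h.svrgH_nonneg hτ
  D₃_nonneg := svrgD₃_nonneg zetaStarSq_nonneg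
  unbiased := h.condExp_mean_direction
  sum_discrepancy := h.sum_discrepancy hτ hγ0 hγ

end Convergence

end LocalSVRG

theorem mainTheorem9 {Ω : Type*} [MeasurableSpace Ω] (P : Measure Ω) [IsProbabilityMeasure P]
    (d n m : ℕ) (hn : 0 < n) (hm : 0 < m)
    (F : Fin n → Fin m → Vec d → ℝ) (L M μ : ℝ) (hL : 0 ≤ L) (hM : 0 ≤ M) (hμ : 0 ≤ μ)
    (hf_convex : ∀ i, StrongConvexOn Set.univ μ (localObj F i))
    (hf_smooth : ∀ i, IsSmooth L (localObj F i))
    (hF_convex : ∀ i j, ConvexOn ℝ Set.univ (F i j))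
    (hF_smooth : ∀ i j, IsSmooth M (F i j))
    (xs : Vec d) (hxs : IsMinOn (globalObj (localObj F)) Set.univ xs)
    (q γ : ℝ) (hq0 : 0 < q) (hq1 : q < 1) (τ : ℕ) (hτ : 1 ≤ τ)
    (hγ0 : 0 < γ) (hγ : StepsizeOK n τ L M q γ)
    (x0 : Vec d) (w0 : Fin n → Vec d)
    (J : ℕ → Fin n → Ω → Fin m) (B : ℕ → Fin n → Ω → Bool) (hJB : IsSampling P q J B) :
    HeteroAssumption P (localObj F) xs
        (iterate F γ τ x0 w0 J B) (stochGrad F γ τ x0 w0 J B) (sigmaSq F γ τ x0 w0 J B xs)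
        (svrgMoment n L M q (zetaStarSq (localObj F) xs))
        (svrgHetero L M (zetaStarSq (localObj F) xs)) ∧
    KeyAssumption P (localObj F) xs
        (iterate F γ τ x0 w0 J B) (stochGrad F γ τ x0 w0 J B) (sigmaSq F γ τ x0 w0 J B xs)
        (history J B) L μ γ
        (svrgMoment n L M q (zetaStarSq (localObj F) xs))
        (svrgH τ q γ) (svrgD₃ τ (zetaStarSq (localObj F) xs)) ∧
    (∀ K : ℕ, Integrable (fun ω => globalObj (localObj F)
        (weightedAvg γ μ q (fun k => mean fun i => iterate F γ τ x0 w0 J B k i ω) K)) P) ∧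
    (∀ K : ℕ,
      ∫ ω, (globalObj (localObj F)
          (weightedAvg γ μ q (fun k => mean fun i => iterate F γ τ x0 w0 J B k i ω) K)
          - globalObj (localObj F) xs) ∂P ≤
        Phi0 n τ L q γ ‖x0 - xs‖ (refVariance F xs w0) / (γ * weightSum γ μ q K)
          + 24 * Real.exp 1 * L * ((τ : ℝ) - 1) ^ 2 * zetaStarSq (localObj F) xs * γ ^ 2) ∧
    (0 < μ → ∀ K : ℕ,
      ∫ ω, (globalObj (localObj F)
          (weightedAvg γ μ q (fun k => mean fun i => iterate F γ τ x0 w0 J B k i ω) K)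
          - globalObj (localObj F) xs) ∂P ≤
        (1 - min (γ * μ) (q / 4)) ^ K *
            (Phi0 n τ L q γ ‖x0 - xs‖ (refVariance F xs w0) / γ)
          + 24 * Real.exp 1 * L * ((τ : ℝ) - 1) ^ 2 * zetaStarSq (localObj F) xs * γ ^ 2) ∧
    (μ = 0 → ∀ K : ℕ, 1 ≤ K →
      ∫ ω, (globalObj (localObj F)
          (weightedAvg γ μ q (fun k => mean fun i => iterate F γ τ x0 w0 J B k i ω) K)
          - globalObj (localObj F) xs) ∂P ≤
        Phi0 n τ L q γ ‖x0 - xs‖ (refVariance F xs w0) / (γ * K)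
          + 24 * Real.exp 1 * L * ((τ : ℝ) - 1) ^ 2 * zetaStarSq (localObj F) xs * γ ^ 2) := by
  have h : Setting P F L M μ xs q J B := ⟨hn, hm, hL, hM, hμ, hf_convex, hf_smooth, hF_convex,
    hF_smooth, hxs, hq0, hq1, hJB⟩
  refine ⟨h.heteroAssumption, h.keyAssumption hτ hγ0 hγ, fun K => ?_,
    h.integral_gap_weightedAvg_le hτ hγ0 hγ, fun _ K => ?_, fun hμ0 K hK => ?_⟩
  · have h1 := (h.integrable_gap_weightedAvg (γ := γ) (τ := τ) (x0 := x0) (w0 := w0) K).add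
      (integrable_const (globalObj (localObj F) xs))
    exact h1.congr (Filter.Eventually.of_forall fun ω => sub_add_cancel _ _)
  · exact (h.integral_gap_weightedAvg_le hτ hγ0 hγ K).trans
      (add_le_add_left (h.div_weightSum_le_pow_mul hτ hγ0 K) _)
  · exact (h.integral_gap_weightedAvg_le hτ hγ0 hγ K).trans
      (add_le_add_left (h.div_weightSum_le_div hτ hγ0 hμ0 hK) _)
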